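/- Computational model: the word RAM with words of $O(\log n)$ bits ($n$ = number of vertices of the input): for some constant $c$, one fixed program must work with every word length $w\ge c(\lfloor\log_2 n\rfloor+1)$; every operation on words costs one unit of time. Algorithms are either deterministic, or randomized with worst-case time bound and success probability at least $2/3$; the statement below holds for each of these two readings of "algorithm" (the same one in the hypothesis and in the conclusion). **$(k,3)$-Hyperclique Hypothesis.** For no constant $\varepsilon>0$ is there an $O(n^{k-\varepsilon})$ time algorithm which, given a $3$-uniform hypergraph with $n\ge 1$ vertices (as its adjacency tensor), decides whether it has a $k$-clique, i.e. $k$ vertices all of whose $3$-element subsets are hyperedges. **$n$-Pairs Minimum Distance.** Given an unweighted undirected simple graph with $n\ge1$ vertices and $m$ edges (as a list of its edges) and a nonempty list of at most $n$ pairs of vertices $(s_i,t_i)$, determine $d=\min_i d(s_i,t_i)\in\{0,1,2,\dots\}\cup\{\infty\}$. An algorithm has approximation ratio $\alpha$ if it always outputs (in the randomized case: outputs with probability at least $2/3$) an estimate $\hat d\in\{0,1,2,\dots\}\cup\{\infty\}$ with $d\le \hat d\le\alpha d$. **Statement.** Let $k\ge 4$ be an integer and assume the $(k,3)$-Hyperclique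 Hypothesis. Then for every constant $\alpha<3-6/k$ and every constant $\varepsilon>0$ there is no algorithm for unweighted undirected $n$-Pairs Minimum Distance with approximation ratio $\alpha$ that runs in time 1. $O\big(n^{k/(k-2)-\varepsilon}\big)$, or 2. $O\big(m+n^{k/(k-2)-\varepsilon}\big)$, or 3. $O\big((m+n)\cdot n^{1/(k-2)-\varepsilon}\big)$ (in particular, in time $O\big(m\cdot n^{1/(k-2)-\varepsilon}\big)$). -/

import Mathlib

open scoped ENNReal

namespace FineGrained

/-! ### The word RAM

A machine with finitely many registers (those that occur in its program), a memory of words that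
is addressed by the contents of registers, and words of `w` bits, that is, natural numbers below
`2 ^ w`.  Every instruction and every test of a condition takes one unit of time.  Programs are
written with sequencing, conditionals and loops; a list of instructions with jumps has the same
power up to a constant factor, since a fixed program has boundedly many jump targets. -/

/-- The binary operations of the word RAM.  Results are reduced modulo `2 ^ w`. -/
inductive WordOp
  | plus | minus | times | quot | rem | land | lor | lxor | shiftL | shiftR | less | equal

/-- The value of an operation on two words, before reduction modulo `2 ^ w`. -/
def WordOp.eval (w : ℕ) : WordOp → ℕ → ℕ → ℕ
  | .plus, a, b => a + b
  | .minus, a, b => a + (2 ^ w - b)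
  | .times, a, b => a * b
  | .quot, a, b => a / b
  | .rem, a, b => a % b
  | .land, a, b => a &&& b
  | .lor, a, b => a ||| b
  | .lxor, a, b => a ^^^ b
  | .shiftL, a, b => a <<< b
  | .shiftR, a, b => a >>> b
  | .less, a, b => if a < b then 1 else 0
  | .equal, a, b => if a = b then 1 else 0

/-- Word RAM programs.  Registers are named by natural numbers. -/
inductive Program
  /-- do nothing -/
  | skip
  /-- `reg dst := v` -/
  | const (dst v : ℕ)
  /-- `reg dst := o (reg a) (reg b)` -/
  | op (o : WordOp) (dst a b : ℕ)
  /-- `reg dst := mem (reg addr)` -/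
  | load (dst addr : ℕ)
  /-- `mem (reg addr) := reg src` -/
  | store (addr src : ℕ)
  /-- `reg dst :=` a fair random bit -/
  | flip (dst : ℕ)
  /-- first `p`, then `q` -/
  | seq (p q : Program)
  /-- if `reg c ≠ 0` then `p` else `q` -/
  | ite (c : ℕ) (p q : Program)
  /-- while `reg c ≠ 0` do `p` -/
  | loop (c : ℕ) (p : Program)

/-- The program never asks for a random bit. -/
def Program.Deterministic : Program → Prop
  | .flip _ => False
  | .seq p q => p.Deterministic ∧ q.Deterministic
  | .ite _ p q => p.Deterministic ∧ q.Deterministic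
  | .loop _ p => p.Deterministic
  | _ => True

/-- A configuration: registers, memory, and the random bits that have not been used yet. -/
structure State where
  reg : ℕ → ℕ
  mem : ℕ → ℕ
  coins : ℕ → Bool

/-- Write the value `v`, reduced to a word of `w` bits, into register `r`. -/
def State.setReg (w : ℕ) (s : State) (r v : ℕ) : State :=
  { s with reg := Function.update s.reg r (v % 2 ^ w) }

/-- Write `v` into the memory cell at address `a`. -/
def State.setMem (s : State) (a v : ℕ) : State :=
  { s with mem := Function.update s.mem a v }

/-- Discard the first unused random bit. -/
def State.dropCoin (s : State) : State :=
  { s with coins := fun i => s.coins (i + 1) }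

/-- The initial configuration: the input words stand in the memory from address `0` on, and all
other cells and all registers are `0`. -/
def State.init (w : ℕ) (input : List ℕ) (coins : ℕ → Bool) : State where
  reg := fun _ => 0
  mem := fun a => input.getD a 0 % 2 ^ w
  coins := coins

/-- `Exec w p s s' t`: with words of `w` bits, the program `p` started in configuration `s` halts
in configuration `s'` after exactly `t` units of time. -/
inductive Exec (w : ℕ) : Program → State → State → ℕ → Prop
  | skip (s : State) : Exec w .skip s s 1
  | const (s : State) (dst v : ℕ) : Exec w (.const dst v) s (s.setReg w dst v) 1
  | op (s : State) (o : WordOp) (dst a b : ℕ) :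
      Exec w (.op o dst a b) s (s.setReg w dst (o.eval w (s.reg a) (s.reg b))) 1
  | load (s : State) (dst addr : ℕ) :
      Exec w (.load dst addr) s (s.setReg w dst (s.mem (s.reg addr))) 1
  | store (s : State) (addr src : ℕ) :
      Exec w (.store addr src) s (s.setMem (s.reg addr) (s.reg src)) 1
  | flip (s : State) (dst : ℕ) :
      Exec w (.flip dst) s (s.dropCoin.setReg w dst (if s.coins 0 then 1 else 0)) 1
  | seq {p q : Program} {s s₁ s₂ : State} {t₁ t₂ : ℕ} :
      Exec w p s s₁ t₁ → Exec w q s₁ s₂ t₂ → Exec w (.seq p q) s s₂ (t₁ + t₂)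
  | ite_true {c : ℕ} {p q : Program} {s s₁ : State} {t : ℕ} :
      s.reg c ≠ 0 → Exec w p s s₁ t → Exec w (.ite c p q) s s₁ (t + 1)
  | ite_false {c : ℕ} {p q : Program} {s s₁ : State} {t : ℕ} :
      s.reg c = 0 → Exec w q s s₁ t → Exec w (.ite c p q) s s₁ (t + 1)
  | loop_done {c : ℕ} {p : Program} {s : State} :
      s.reg c = 0 → Exec w (.loop c p) s s 1
  | loop_step {c : ℕ} {p : Program} {s s₁ s₂ : State} {t₁ t₂ : ℕ} :
      s.reg c ≠ 0 → Exec w p s s₁ t₁ → Exec w (.loop c p) s₁ s₂ t₂ →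
        Exec w (.loop c p) s s₂ (t₁ + t₂ + 1)

/-! ### Problems and algorithms -/

/-- A computational problem.  `size` is the parameter that determines the word length, `encode`
is the input as a list of words, and `Correct x out` says that the register contents `out` are a
correct answer on the instance `x`. -/
structure Problem where
  Instance : Type
  size : Instance → ℕ
  encode : Instance → List ℕ
  Correct : Instance → (ℕ → ℕ) → Prop

/-- The two kinds of algorithms: deterministic, and randomized with bounded error. -/
inductive AlgKind
  | deterministic
  | randomized

/-- The law of a sequence of independent fair random bits. -/
noncomputable def coinMeasure : MeasureTheory.Measure (ℕ → Bool) :=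
  MeasureTheory.Measure.infinitePi fun _ => (PMF.uniformOfFintype Bool).toMeasure

/-- With words of `w` bits, the program `p` halts on `input` within time `T`, and its final
register contents satisfy `Q`: always, with a program that uses no random bits, for deterministic
algorithms; with probability at least `2/3` for randomized ones (whose time bound holds for all
outcomes of the random bits). -/
def Program.Achieves (kind : AlgKind) (p : Program) (w : ℕ) (input : List ℕ) (T : ℝ)
    (Q : (ℕ → ℕ) → Prop) : Prop :=
  match kind with
  | .deterministic =>
      p.Deterministic ∧
        ∀ ω, ∃ s t, Exec w p (State.init w input ω) s t ∧ (t : ℝ) ≤ T ∧ Q s.reg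
  | .randomized =>
      (∀ ω, ∃ s t, Exec w p (State.init w input ω) s t ∧ (t : ℝ) ≤ T) ∧
        2 / 3 ≤ coinMeasure {ω | ∃ s t, Exec w p (State.init w input ω) s t ∧ Q s.reg}

/-- The problem has an algorithm of the given kind that runs in time `O(T)` on the word RAM with
words of `O(log n)` bits, `n` being the size of the instance: one program that, for some constant
`c`, works with every word length `w ≥ c (⌊log₂ n⌋ + 1)`. -/
def Problem.SolvableInTime (P : Problem) (kind : AlgKind) (T : P.Instance → ℝ) : Prop :=
  ∃ (p : Program) (c : ℕ) (C : ℝ), ∀ (x : P.Instance) (w : ℕ),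
    c * (Nat.log 2 (P.size x) + 1) ≤ w →
      p.Achieves kind w (P.encode x) (C * T x) (P.Correct x)

/-! ### Detection of cliques in uniform hypergraphs -/

/-- An `r`-uniform hypergraph with vertices `0, …, n - 1`, where `n ≥ 1`. -/
structure UniformHypergraph (r : ℕ) where
  n : ℕ
  n_pos : 0 < n
  edges : Finset (Finset (Fin n))
  uniform : ∀ e ∈ edges, e.card = r

/-- There are `k` vertices all of whose `r`-element subsets are hyperedges. -/
def UniformHypergraph.HasClique {r : ℕ} (H : UniformHypergraph r) (k : ℕ) : Prop :=
  ∃ S : Finset (Fin H.n), S.card = k ∧ ∀ e ⊆ S, e.card = r → e ∈ H.edges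

/-- The input words: `n`, followed by the adjacency tensor, whose entry number
`v₀ + v₁ n + ⋯ + v_{r-1} n ^ (r-1)` is `1` if `{v₀, …, v_{r-1}}` is a hyperedge and `0` if not. -/
def UniformHypergraph.encode {r : ℕ} (H : UniformHypergraph r) : List ℕ :=
  H.n :: List.ofFn fun a : Fin (H.n ^ r) =>
    if Finset.univ.image (finFunctionFinEquiv.symm a) ∈ H.edges then 1 else 0

/-- `k`-clique detection in `r`-uniform hypergraphs.  The answer, `1` for yes and `0` for no, is
expected in register `0`. -/
def hypercliqueDetection (k r : ℕ) : Problem where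
  Instance := UniformHypergraph r
  size := fun H => H.n
  encode := fun H => H.encode
  Correct := fun H out => (H.HasClique k ∧ out 0 = 1) ∨ (¬ H.HasClique k ∧ out 0 = 0)

/-- The `(k, r)`-Hyperclique Hypothesis: for no constant `ε > 0` is there an `O(n ^ (k - ε))` time
algorithm for `k`-clique detection in `r`-uniform hypergraphs with `n` vertices. -/
def HypercliqueHypothesis (kind : AlgKind) (k r : ℕ) : Prop :=
  ∀ ε : ℝ, 0 < ε →
    ¬ (hypercliqueDetection k r).SolvableInTime kind
        (fun H : UniformHypergraph r => (H.n : ℝ) ^ ((k : ℝ) - ε))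

/-! ### `n`-Pairs Minimum Distance -/

/-- An unweighted undirected graph with vertices `0, …, n - 1`, where `n ≥ 1`, given by a list of
its edges in which every edge occurs once, and a nonempty list of at most `n` pairs of vertices. -/
structure PairsInstance where
  n : ℕ
  n_pos : 0 < n
  graph : SimpleGraph (Fin n)
  edgeList : List (Fin n × Fin n)
  edgeList_nodup : (edgeList.map fun e => s(e.1, e.2)).Nodup
  mem_edgeList : ∀ e : Sym2 (Fin n), e ∈ edgeList.map (fun e => s(e.1, e.2)) ↔ e ∈ graph.edgeSet
  pairs : List (Fin n × Fin n)
  pairs_ne_nil : pairs ≠ []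
  length_pairs_le : pairs.length ≤ n

/-- The number of edges. -/
def PairsInstance.m (I : PairsInstance) : ℕ := I.edgeList.length

/-- The `n`-pairs minimum distance, the minimum of `d(s, t)` over the given pairs `(s, t)`; it is
`⊤` if no pair is connected. -/
noncomputable def PairsInstance.minDist (I : PairsInstance) : ℕ∞ :=
  ⨅ q ∈ I.pairs, I.graph.edist q.1 q.2

/-- The input words: `n`, `m`, the number of pairs, the endpoints of the edges, the pairs. -/
def PairsInstance.encode (I : PairsInstance) : List ℕ :=
  [I.n, I.m, I.pairs.length] ++
    (I.edgeList ++ I.pairs).flatMap fun q => [(q.1 : ℕ), (q.2 : ℕ)]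

/-- The estimate that a machine announces: infinite if register `0` is `0`, and otherwise the
content of register `1`. -/
def outputEstimate (out : ℕ → ℕ) : ℕ∞ := if out 0 = 0 then ⊤ else (out 1 : ℕ∞)

/-- Approximation of the `n`-pairs minimum distance `d` with ratio `α`: the answer is an estimate
`d'` with `d ≤ d' ≤ α d`. -/
noncomputable def pairsMinDistApprox (α : ℝ) : Problem where
  Instance := PairsInstance
  size := fun I => I.n
  encode := fun I => I.encode
  Correct := fun I out =>
    I.minDist ≤ outputEstimate out ∧
      ((outputEstimate out : ℕ∞) : ℝ≥0∞) ≤ ENNReal.ofReal α * ((I.minDist : ℕ∞) : ℝ≥0∞)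

end FineGrained

namespace FineGrained

/-! ### Reasoning about word RAM programs -/

/-- Started in `s`, the program `p` halts within time `T`, in a configuration that satisfies `Q`. -/
def Program.Halts (w : ℕ) (p : Program) (T : ℕ) (Q : State → Prop) (s : State) : Prop :=
  ∃ s' t, Exec w p s s' t ∧ t ≤ T ∧ Q s'

/-- Write the value `v` into register `r`, without reduction. -/
def State.put (s : State) (r v : ℕ) : State :=
  { s with reg := Function.update s.reg r v }

@[simp] theorem State.put_reg (s : State) (r v r' : ℕ) :
    (s.put r v).reg r' = if r' = r then v else s.reg r' := by
  simp [State.put, Function.update_apply]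

@[simp] theorem State.put_mem (s : State) (r v : ℕ) : (s.put r v).mem = s.mem := rfl

@[simp] theorem State.setMem_reg (s : State) (a v : ℕ) : (s.setMem a v).reg = s.reg := rfl

@[simp] theorem State.setMem_mem (s : State) (a v : ℕ) :
    (s.setMem a v).mem = Function.update s.mem a v := rfl

theorem State.setReg_eq_put {w v : ℕ} (h : v < 2 ^ w) (s : State) (r : ℕ) :
    s.setReg w r v = s.put r v := by
  simp [State.setReg, State.put, Nat.mod_eq_of_lt h]

/-- The programs of a list, one after the other. -/
def Program.block : List Program → Program
  | [] => .skip
  | p :: l => .seq p (block l)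

/-- The program `p`, `n` times. -/
def Program.rep (n : ℕ) (p : Program) : Program := Program.block (List.replicate n p)

theorem Program.block_deterministic {l : List Program} (h : ∀ p ∈ l, p.Deterministic) :
    (Program.block l).Deterministic := by
  induction l with
  | nil => trivial
  | cons p l ih =>
    exact ⟨h p (by simp), ih fun q hq => h q (by simp [hq])⟩

theorem Program.rep_deterministic {n : ℕ} {p : Program} (h : p.Deterministic) :
    (Program.rep n p).Deterministic :=
  Program.block_deterministic fun q hq => by rw [List.eq_of_mem_replicate hq]; exact h

section Rules

variable {w T T' : ℕ} {p q : Program} {l : List Program} {Q R : State → Prop} {s : State}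

theorem Program.Halts.mono (h : p.Halts w T Q s) (hT : T ≤ T') (hQ : ∀ s, Q s → R s) :
    p.Halts w T' R s := by
  obtain ⟨s', t, h1, h2, h3⟩ := h
  exact ⟨s', t, h1, h2.trans hT, hQ _ h3⟩

theorem Program.Halts.seq (h : p.Halts w T (q.Halts w T' Q) s) :
    (Program.seq p q).Halts w (T + T') Q s := by
  obtain ⟨s', t, h1, h2, s'', t', h3, h4, h5⟩ := h
  exact ⟨s'', t + t', .seq h1 h3, by omega, h5⟩

theorem halts_block_nil (h : Q s) : (Program.block []).Halts w (T + 1) Q s :=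
  ⟨s, 1, .skip s, by omega, h⟩

theorem halts_block_cons (h : p.Halts w T ((Program.block l).Halts w T' Q) s) :
    (Program.block (p :: l)).Halts w (T + T') Q s :=
  Program.Halts.seq h

theorem halts_op (o : WordOp) (dst a b v : ℕ) (hv : o.eval w (s.reg a) (s.reg b) = v)
    (hlt : v < 2 ^ w) (h : (Program.block l).Halts w T Q (s.put dst v)) :
    (Program.block (.op o dst a b :: l)).Halts w (T + 1) Q s := by
  rw [add_comm]
  refine halts_block_cons ⟨_, 1, .op s o dst a b, le_rfl, ?_⟩
  rwa [hv, State.setReg_eq_put hlt]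

theorem halts_const (dst v : ℕ) (hlt : v < 2 ^ w)
    (h : (Program.block l).Halts w T Q (s.put dst v)) :
    (Program.block (.const dst v :: l)).Halts w (T + 1) Q s := by
  rw [add_comm]
  refine halts_block_cons ⟨_, 1, .const s dst v, le_rfl, ?_⟩
  rwa [State.setReg_eq_put hlt]

theorem halts_load (dst addr v : ℕ) (hv : s.mem (s.reg addr) = v) (hlt : v < 2 ^ w)
    (h : (Program.block l).Halts w T Q (s.put dst v)) :
    (Program.block (.load dst addr :: l)).Halts w (T + 1) Q s := by
  rw [add_comm]
  refine halts_block_cons ⟨_, 1, .load s dst addr, le_rfl, ?_⟩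
  rwa [hv, State.setReg_eq_put hlt]

theorem halts_store (addr src a v : ℕ) (ha : s.reg addr = a) (hv : s.reg src = v)
    (h : (Program.block l).Halts w T Q (s.setMem a v)) :
    (Program.block (.store addr src :: l)).Halts w (T + 1) Q s := by
  rw [add_comm]
  refine halts_block_cons ⟨_, 1, .store s addr src, le_rfl, ?_⟩
  rwa [ha, hv]

theorem halts_plus (dst a b v : ℕ) (hv : s.reg a + s.reg b = v) (hlt : v < 2 ^ w)
    (h : (Program.block l).Halts w T Q (s.put dst v)) :
    (Program.block (.op .plus dst a b :: l)).Halts w (T + 1) Q s :=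
  halts_op .plus dst a b v hv hlt h

theorem halts_times (dst a b v : ℕ) (hv : s.reg a * s.reg b = v) (hlt : v < 2 ^ w)
    (h : (Program.block l).Halts w T Q (s.put dst v)) :
    (Program.block (.op .times dst a b :: l)).Halts w (T + 1) Q s :=
  halts_op .times dst a b v hv hlt h

theorem halts_quot (dst a b v : ℕ) (hv : s.reg a / s.reg b = v) (hlt : v < 2 ^ w)
    (h : (Program.block l).Halts w T Q (s.put dst v)) :
    (Program.block (.op .quot dst a b :: l)).Halts w (T + 1) Q s :=
  halts_op .quot dst a b v hv hlt h

theorem halts_rem (dst a b v : ℕ) (hv : s.reg a % s.reg b = v) (hlt : v < 2 ^ w)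
    (h : (Program.block l).Halts w T Q (s.put dst v)) :
    (Program.block (.op .rem dst a b :: l)).Halts w (T + 1) Q s :=
  halts_op .rem dst a b v hv hlt h

theorem halts_minus (dst a b v : ℕ) (hv : s.reg a = v + s.reg b) (hlt : s.reg a < 2 ^ w)
    (h : (Program.block l).Halts w T Q (s.put dst v)) :
    (Program.block (.op .minus dst a b :: l)).Halts w (T + 1) Q s := by
  rw [add_comm]
  refine halts_block_cons ⟨_, 1, .op s .minus dst a b, le_rfl, ?_⟩
  have h1 : WordOp.eval w .minus (s.reg a) (s.reg b) = v + 2 ^ w := by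
    simp only [WordOp.eval]; omega
  have h2 : s.setReg w dst (v + 2 ^ w) = s.put dst v := by
    rw [State.setReg, State.put, Nat.add_mod_right, Nat.mod_eq_of_lt (by omega)]
  rwa [h1, h2]

theorem halts_rep (Inv : ℕ → State → Prop) (n : ℕ)
    (hstep : ∀ i < n, ∀ s, Inv i s → p.Halts w T (Inv (i + 1)) s) (h0 : Inv 0 s) :
    (Program.rep n p).Halts w (T * n + 1) (Inv n) s := by
  suffices H : ∀ m j, j + m = n → ∀ s, Inv j s →
      (Program.block (List.replicate m p)).Halts w (T * m + 1) (Inv n) s from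
    H n 0 (by omega) s h0
  intro m
  induction m with
  | zero =>
    intro j hj s hs
    rw [add_zero] at hj
    exact halts_block_nil (hj ▸ hs)
  | succ m ih =>
    intro j hj s hs
    have h1 := hstep j (by omega) s hs
    have h2 : (Program.block (List.replicate (m + 1) p)).Halts w (T + (T * m + 1)) (Inv n) s :=
      halts_block_cons (h1.mono le_rfl fun s' hs' => ih (j + 1) (by omega) s' hs')
    exact h2.mono (by rw [Nat.mul_succ]; omega) fun _ h => h

theorem halts_countdown (c : ℕ) (Inv : ℕ → State → Prop) (hreg : ∀ j s, Inv j s → s.reg c = j)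
    (hstep : ∀ j s, Inv (j + 1) s → p.Halts w T (Inv j) s) (n : ℕ) (h0 : Inv n s) :
    (Program.loop c p).Halts w ((T + 1) * n + 1) (Inv 0) s := by
  induction n generalizing s with
  | zero => exact ⟨s, 1, .loop_done (hreg _ _ h0), by omega, h0⟩
  | succ n ih =>
    obtain ⟨s₁, t₁, h1, h2, h3⟩ := hstep n s h0
    obtain ⟨s₂, t₂, h4, h5, h6⟩ := ih h3
    refine ⟨s₂, t₁ + t₂ + 1, .loop_step (by rw [hreg _ _ h0]; omega) h1 h4, ?_, h6⟩
    rw [Nat.mul_succ]; omega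

theorem halts_ite (c : ℕ) (h1 : s.reg c ≠ 0 → p.Halts w T Q s)
    (h2 : s.reg c = 0 → q.Halts w T Q s) : (Program.ite c p q).Halts w (T + 1) Q s := by
  by_cases hc : s.reg c = 0
  · obtain ⟨s', t, h3, h4, h5⟩ := h2 hc
    exact ⟨s', t + 1, .ite_false hc h3, by omega, h5⟩
  · obtain ⟨s', t, h3, h4, h5⟩ := h1 hc
    exact ⟨s', t + 1, .ite_true hc h3, by omega, h5⟩

theorem halts_skip (h : Q s) : Program.skip.Halts w (T + 1) Q s :=
  ⟨s, 1, .skip s, by omega, h⟩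

end Rules

/-! ### The program that writes the layered graph -/

/-- The digit number `d` of `u` in base `N`. -/
def digit (N u d : ℕ) : ℕ := u / N ^ d % N

theorem digit_lt {N : ℕ} (hN : 0 < N) (u d : ℕ) : digit N u d < N := Nat.mod_lt _ hN

/-- The triples of different numbers below `k - 1`. -/
def digitTriples (k : ℕ) : List (ℕ × ℕ × ℕ) :=
  (List.range (k - 1) ×ˢ List.range (k - 1) ×ˢ List.range (k - 1)).filter
    fun t => t.1 ≠ t.2.1 ∧ t.1 ≠ t.2.2 ∧ t.2.1 ≠ t.2.2

/-- The entry of the adjacency tensor at the digits number `t` of `u`, where `X` lists `N` and the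
tensor. -/
def tensorEntry (N : ℕ) (X : List ℕ) (u : ℕ) (t : ℕ × ℕ × ℕ) : ℕ :=
  X.getD (1 + (digit N u t.1 + N * (digit N u t.2.1 + N * digit N u t.2.2))) 0

/-- All triples of different digits of `u` are hyperedges. -/
def AllTriples (k N : ℕ) (X : List ℕ) (u : ℕ) : Prop :=
  ∀ t ∈ digitTriples k, tensorEntry N X u t = 1

instance (k N : ℕ) (X : List ℕ) : DecidablePred (AllTriples k N X) := fun _ =>
  inferInstanceAs (Decidable (∀ _ ∈ _, _))

/-- The words that encode the edges of the layered graph that belong to `u`. -/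
def edgeWords (k N M : ℕ) (X : List ℕ) (u : ℕ) : List ℕ :=
  if AllTriples k N X u then
    (List.range k).flatMap fun i => [i * M + u % M, (i + 1) * M + u / N]
  else []

/-- The words that encode the pair of the two copies of `y` in the first and the last layer. -/
def pairWords (k M : ℕ) (y : ℕ) : List ℕ := [y, k * M + y]

/-- All edge words. -/
def allEdgeWords (k N M U : ℕ) (X : List ℕ) : List ℕ :=
  (List.range U).reverse.flatMap (edgeWords k N M X)

/-- All pair words. -/
def allPairWords (k M : ℕ) : List ℕ := (List.range M).reverse.flatMap (pairWords k M)

/-- The relations between the numbers that occur in the reduction: `N` vertices of the hypergraph,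
layers of size `M`, `U` candidates for edges between two layers, an auxiliary region of the memory
that starts at address `B`. -/
structure Layout (w k N M U B : ℕ) : Prop where
  k_ge : 4 ≤ k
  N_pos : 0 < N
  M_eq : M = N ^ (k - 2)
  U_eq : U = M * N
  B_eq : B = (2 * k + 5) * U
  cube_le : N ^ 3 ≤ U
  lt_word : B + N ^ 3 + 1 < 2 ^ w

theorem Layout.M_pos {w k N M U B : ℕ} (h : Layout w k N M U B) : 0 < M := by
  rw [h.M_eq]; exact pow_pos h.N_pos _

theorem Layout.M_le {w k N M U B : ℕ} (h : Layout w k N M U B) : M ≤ U := by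
  rw [h.U_eq]; exact Nat.le_mul_of_pos_right _ h.N_pos

theorem Layout.cube_pos {w k N M U B : ℕ} (h : Layout w k N M U B) : 0 < N ^ 3 :=
  pow_pos h.N_pos _

theorem Layout.mul_le {w k N M U B : ℕ} (h : Layout w k N M U B) {c x : ℕ} (hc : c ≤ 2 * k + 5)
    (hx : x ≤ U) : c * x ≤ B := by
  rw [h.B_eq]; exact Nat.mul_le_mul hc hx

theorem Layout.U_le {w k N M U B : ℕ} (h : Layout w k N M U B) : 13 * U ≤ B :=
  h.mul_le (by have := h.k_ge; omega) le_rfl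

theorem Layout.k_le {w k N M U B : ℕ} (h : Layout w k N M U B) : 2 * k + 5 ≤ B := by
  have h1 := h.mul_le (c := 2 * k + 5) (x := 1) le_rfl (h.M_pos.trans_le h.M_le)
  omega

/-- The registers that keep their values during the construction. -/
structure Ctx (N M U B : ℕ) (ω : ℕ → Bool) (s : State) : Prop where
  reg0 : s.reg 0 = 0
  reg1 : s.reg 1 = N
  reg2 : s.reg 2 = M
  reg3 : s.reg 3 = U
  reg4 : s.reg 4 = B
  reg5 : s.reg 5 = 1
  reg6 : s.reg 6 = N ^ 3 + 1
  high : ∀ r, 19 ≤ r → s.reg r = 0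
  coins : s.coins = ω

section Ctx

variable {N M U B : ℕ} {ω : ℕ → Bool} {s : State}

theorem Ctx.put (h : Ctx N M U B ω s) (r v : ℕ) (hr : 7 ≤ r ∧ r < 19) :
    Ctx N M U B ω (s.put r v) := by
  have key : ∀ r', r' ≠ r → (s.put r v).reg r' = s.reg r' := fun r' hr' => by simp [hr']
  refine ⟨?_, ?_, ?_, ?_, ?_, ?_, ?_, fun r' hr' => ?_, h.coins⟩
  · rw [key _ (by omega), h.reg0]
  · rw [key _ (by omega), h.reg1]
  · rw [key _ (by omega), h.reg2]
  · rw [key _ (by omega), h.reg3]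
  · rw [key _ (by omega), h.reg4]
  · rw [key _ (by omega), h.reg5]
  · rw [key _ (by omega), h.reg6]
  · rw [key _ (by omega), h.high _ hr']

theorem Ctx.setMem (h : Ctx N M U B ω s) (a v : ℕ) : Ctx N M U B ω (s.setMem a v) :=
  ⟨h.reg0, h.reg1, h.reg2, h.reg3, h.reg4, h.reg5, h.reg6, h.high, h.coins⟩

end Ctx

/-- The memory that holds the list `L` from address `0` and the list `X` from address `B`. -/
def memOf (B : ℕ) (L X : List ℕ) (a : ℕ) : ℕ := if a < B then L.getD a 0 else X.getD (a - B) 0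

theorem memOf_push {B : ℕ} {L : List ℕ} (hL : L.length < B) (X : List ℕ) (v : ℕ) :
    Function.update (memOf B L X) L.length v = memOf B (L ++ [v]) X := by
  ext a
  rw [Function.update_apply, memOf, memOf]
  rcases lt_trichotomy a L.length with h | h | h
  · rw [if_neg h.ne, List.getD_append _ _ _ _ h]
  · subst h
    rw [if_pos rfl, if_pos hL, List.getD_append_right _ _ _ _ le_rfl]
    simp
  · have h' : (L ++ [v]).length ≤ a := by rw [List.length_append]; exact h
    rw [if_neg h.ne', List.getD_eq_default _ _ h.le, List.getD_eq_default _ _ h']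

theorem memOf_set {B i : ℕ} {L : List ℕ} (hi : i < L.length) (hL : L.length ≤ B) (X : List ℕ)
    (v : ℕ) : Function.update (memOf B L X) i v = memOf B (L.set i v) X := by
  ext a
  rw [Function.update_apply, memOf, memOf]
  by_cases h : a = i
  · subst h
    rw [if_pos rfl, if_pos (hi.trans_le hL)]
    simp [List.getD_eq_getElem?_getD, hi]
  · rw [if_neg h]
    simp [List.getD_eq_getElem?_getD, Ne.symm h]

/-- A configuration while the output is written: `L` has been written, and the input `X` stands in
the auxiliary region. -/
structure Writing (N M U B : ℕ) (ω : ℕ → Bool) (X L : List ℕ) (s : State) : Prop where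
  ctx : Ctx N M U B ω s
  ptr : s.reg 7 = L.length
  mem : s.mem = memOf B L X

theorem Writing.put {N M U B : ℕ} {ω : ℕ → Bool} {X L : List ℕ} {s : State}
    (h : Writing N M U B ω X L s) (r v : ℕ) (hr : 8 ≤ r ∧ r < 19) :
    Writing N M U B ω X L (s.put r v) :=
  ⟨h.ctx.put r v (by omega), by rw [State.put_reg, if_neg (by omega), h.ptr], h.mem⟩

/-- Writing one word and increasing the pointer. -/
theorem halts_push {w k N M U B T : ℕ} (hl : Layout w k N M U B) {ω : ℕ → Bool} {X L : List ℕ}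
    {l : List Program} {Q : State → Prop} {s : State} (src v : ℕ) (hv : s.reg src = v)
    (hs : Writing N M U B ω X L s) (hL : L.length < B)
    (h : ∀ s', Writing N M U B ω X (L ++ [v]) s' → (∀ r, r ≠ 7 → s'.reg r = s.reg r) →
      (Program.block l).Halts w T Q s') :
    (Program.block (.store 7 src :: .op .plus 7 7 5 :: l)).Halts w (T + 1 + 1) Q s := by
  have hlt := hl.lt_word
  refine halts_store 7 src L.length v hs.ptr hv ?_
  refine halts_plus 7 7 5 (L.length + 1) (by simp [hs.ptr, hs.ctx.reg5]) (by omega) ?_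
  refine h _ ⟨(hs.ctx.setMem _ _).put _ _ (by omega), by simp, ?_⟩ fun r hr => by simp [hr]
  rw [State.put_mem, State.setMem_mem, hs.mem, memOf_push hL]

/-- Read the input length parameter and compute the constants. -/
def setupProgram (k : ℕ) : Program :=
  .block [.const 5 1, .load 1 0, .const 2 1, .rep (k - 2) (.block [.op .times 2 2 1]),
    .op .times 3 2 1, .const 10 (2 * k + 5), .op .times 4 10 3, .op .times 6 1 1,
    .op .times 6 6 1, .op .plus 6 6 5]

/-- Move the input to the auxiliary region. -/
def moveProgram : Program :=
  .block [.op .plus 8 6 0,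
    .loop 8 (.block [.op .minus 8 8 5, .load 10 8, .op .plus 11 4 8, .store 11 10, .store 8 0])]

/-- Write the number of vertices, a place holder for the number of edges, the number of pairs. -/
def headerProgram (k : ℕ) : Program :=
  .block [.const 10 (k + 1), .op .times 11 10 2, .const 7 0, .store 7 11, .op .plus 7 7 5,
    .store 7 0, .op .plus 7 7 5, .store 7 2, .op .plus 7 7 5]

/-- Compute the digit number `d` of the counter. -/
def digitProgram (dst d : ℕ) : Program :=
  .block [.op .plus dst 8 0, .rep d (.block [.op .quot dst dst 1]), .op .rem dst dst 1]

/-- Multiply the flag with an entry of the tensor. -/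
def checkProgram (t : ℕ × ℕ × ℕ) : Program :=
  .block [digitProgram 10 t.1, digitProgram 11 t.2.1, digitProgram 12 t.2.2, .op .times 12 12 1,
    .op .plus 12 12 11, .op .times 12 12 1, .op .plus 12 12 10, .op .plus 12 12 5,
    .op .plus 12 12 4, .load 10 12, .op .times 9 9 10]

/-- Write the edges that belong to the counter. -/
def emitProgram (k : ℕ) : Program :=
  .block [.op .rem 17 8 2, .op .quot 18 8 1, .const 15 0,
    .rep k (.block [.op .plus 10 15 17, .store 7 10, .op .plus 7 7 5, .op .plus 15 15 2,
      .op .plus 10 15 18, .store 7 10, .op .plus 7 7 5])]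

/-- Write all edges. -/
def edgeProgram (k : ℕ) : Program :=
  .block [.op .plus 8 3 0,
    .loop 8 (.block [.op .minus 8 8 5, .const 9 1, .block ((digitTriples k).map checkProgram),
      .ite 9 (emitProgram k) .skip])]

/-- Write the number of edges. -/
def countProgram : Program :=
  .block [.const 10 3, .op .minus 10 7 10, .const 11 2, .op .quot 10 10 11, .store 5 10]

/-- Write the pairs. -/
def pairProgram (k : ℕ) : Program :=
  .block [.op .plus 8 2 0, .const 10 k, .op .times 15 10 2,
    .loop 8 (.block [.op .minus 8 8 5, .store 7 8, .op .plus 7 7 5, .op .plus 10 15 8,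
      .store 7 10, .op .plus 7 7 5])]

/-- Clear the auxiliary region. -/
def clearProgram : Program :=
  .block [.op .plus 8 6 0, .loop 8 (.block [.op .minus 8 8 5, .op .plus 10 4 8, .store 10 0])]

/-- Clear the registers. -/
def resetProgram : Program := .block ((List.range 19).map fun r => .const r 0)

section Correctness

variable {w k N M U B : ℕ} {ω : ℕ → Bool} {X L : List ℕ} {s : State}

theorem setupProgram_halts (hl : Layout w k N M U B) (hX : X.getD 0 0 = N)
    (hXw : ∀ a, X.getD a 0 < 2 ^ w) :
    (setupProgram k).Halts w (2 * k + 20)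
      (fun s => Ctx N M U B ω s ∧ s.mem = fun a => X.getD a 0) (State.init w X ω) := by
  have hk := hl.k_ge
  have hlt := hl.lt_word
  have hU := hl.U_le
  have hMU := hl.M_le
  have hkB := hl.k_le
  have hN3 := hl.cube_le
  have hN2 : N * N ≤ N ^ 3 := by
    rw [show N ^ 3 = N * N * N by ring]; exact Nat.le_mul_of_pos_right _ hl.N_pos
  have hN1 : N ≤ N * N := Nat.le_mul_of_pos_right _ hl.N_pos
  have hmem : (State.init w X ω).mem = fun a => X.getD a 0 := by
    ext a; exact Nat.mod_eq_of_lt (hXw a)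
  have hreg : ∀ r, (State.init w X ω).reg r = 0 := fun _ => rfl
  refine Program.Halts.mono
    (T := ((0 + 1 + 1) * (k - 2) + 1) + (0 + 1 + 1 + 1 + 1 + 1 + 1 + 1) + 1 + 1 + 1)
    ?_ (by omega) (fun _ h => h)
  refine halts_const 5 1 (by omega) ?_
  refine halts_load 1 0 N (by simp [hmem, hreg]; exact hX) (by omega) ?_
  refine halts_const 2 1 (by omega) ?_
  refine halts_block_cons (T := (0 + 1 + 1) * (k - 2) + 1) (T' := 7) ?_
  refine (halts_rep (fun i s => s.reg 1 = N ∧ s.reg 5 = 1 ∧ s.reg 2 = N ^ i ∧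
    (∀ r, 6 ≤ r → s.reg r = 0) ∧ s.reg 0 = 0 ∧ s.coins = ω ∧ s.mem = fun a => X.getD a 0) (k - 2)
    ?_ ?_).mono le_rfl ?_
  · rintro i hi s ⟨h1, h5, h2, hr, h0, hc, hm⟩
    have hpow : N ^ (i + 1) ≤ M := by
      rw [hl.M_eq]; exact Nat.pow_le_pow_right hl.N_pos (by omega)
    refine halts_times 2 2 1 (N ^ (i + 1)) (by rw [h1, h2, pow_succ]) (by omega) ?_
    refine halts_block_nil ⟨by simp [h1], by simp [h5], by simp, fun r h => ?_, by simp [h0], hc, hm⟩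
    rw [State.put_reg, if_neg (by omega), hr r h]
  · refine ⟨by simp, by simp, by simp, fun r h => ?_, by simp [hreg], rfl, by simp [hmem]⟩
    simp only [State.put_reg]
    rw [if_neg (by omega), if_neg (by omega), if_neg (by omega), hreg]
  · rintro s ⟨h1, h5, h2, hr, h0, hc, hm⟩
    rw [← hl.M_eq] at h2
    refine halts_times 3 2 1 U (by rw [h1, h2, hl.U_eq]) (by omega) ?_
    refine halts_const 10 (2 * k + 5) (by omega) ?_
    refine halts_times 4 10 3 B (by simp [hl.B_eq]) (by omega) ?_
    refine halts_times 6 1 1 (N * N) (by simp [h1]) (by omega) ?_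
    refine halts_times 6 6 1 (N ^ 3) (by simp [h1]; ring) (by omega) ?_
    refine halts_plus 6 6 5 (N ^ 3 + 1) (by simp [h5]) (by omega) ?_
    refine halts_block_nil ⟨⟨by simp [h0], by simp [h1], by simp [h2], by simp, by simp,
      by simp [h5], by simp, fun r hr' => ?_, hc⟩, hm⟩
    simp only [State.put_reg]
    rw [if_neg (by omega), if_neg (by omega), if_neg (by omega), if_neg (by omega),
      if_neg (by omega), if_neg (by omega), hr r (by omega)]

theorem moveProgram_halts (hl : Layout w k N M U B) (hX : X.length = N ^ 3 + 1)
    (hXw : ∀ a, X.getD a 0 < 2 ^ w) (hs : Ctx N M U B ω s)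
    (hm : s.mem = fun a => X.getD a 0) :
    moveProgram.Halts w (7 * (N ^ 3 + 1) + 3)
      (fun s => Ctx N M U B ω s ∧ s.mem = memOf B [] X) s := by
  have hlt := hl.lt_word
  have hU := hl.U_le
  have hN3 := hl.cube_le
  have hpos := hl.cube_pos
  refine Program.Halts.mono
    (T := ((0 + 1 + 1 + 1 + 1 + 1 + 1 + 1) * (N ^ 3 + 1) + 1) + (0 + 1) + 1)
    ?_ (by omega) (fun _ h => h)
  refine halts_plus 8 6 0 (N ^ 3 + 1) (by simp [hs.reg6, hs.reg0]) (by omega) ?_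
  refine halts_block_cons (T := (0 + 1 + 1 + 1 + 1 + 1 + 1 + 1) * (N ^ 3 + 1) + 1) (T' := 1) ?_
  refine (halts_countdown 8 (fun j s => s.reg 8 = j ∧ Ctx N M U B ω s ∧ j ≤ N ^ 3 + 1 ∧
    ∀ a, s.mem a = if a < B then (if a < j then X.getD a 0 else 0)
      else (if a - B < j then 0 else X.getD (a - B) 0)) (fun j s h => h.1) ?_ (N ^ 3 + 1) ?_).mono
      le_rfl ?_
  · rintro j s ⟨h8, hc, hj, hm⟩
    have hmj : s.mem j = X.getD j 0 := by rw [hm, if_pos (by omega), if_pos (by omega)]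
    refine halts_minus 8 8 5 j (by simp [h8, hc.reg5]) (by omega) ?_
    refine halts_load 10 8 (X.getD j 0) (by simpa using hmj) (hXw j) ?_
    refine halts_plus 11 4 8 (B + j) (by simp [hc.reg4]) (by omega) ?_
    refine halts_store 11 10 (B + j) (X.getD j 0) (by simp) (by simp) ?_
    refine halts_store 8 0 j 0 (by simp) (by simp [hc.reg0]) ?_
    refine halts_block_nil ⟨by simp, ?_, by omega, fun a => ?_⟩
    · exact ((((hc.put _ _ (by omega)).put _ _ (by omega)).put _ _ (by omega)).setMem _ _).setMem _ _
    · simp only [State.setMem_mem, State.put_mem, Function.update_apply, hm]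
      by_cases h1 : a = j
      · subst h1
        rw [if_pos rfl, if_pos (by omega), if_neg (by omega)]
      · rw [if_neg h1]
        by_cases h2 : a = B + j
        · subst h2
          rw [if_pos rfl, if_neg (by omega), if_neg (by omega), Nat.add_sub_cancel_left]
        · rw [if_neg h2]
          split_ifs <;> first | rfl | omega
  · refine ⟨by simp, hs.put _ _ (by omega), le_rfl, fun a => ?_⟩
    rw [State.put_mem, hm]
    by_cases h1 : a < N ^ 3 + 1
    · rw [if_pos (by omega), if_pos h1]
    · have h2 : X.getD a 0 = 0 := List.getD_eq_default _ _ (by omega)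
      have h3 : ¬ a - B < N ^ 3 + 1 → X.getD (a - B) 0 = 0 :=
        fun h => List.getD_eq_default _ _ (by omega)
      simp only [h2]
      split_ifs with h4 h5
      · rfl
      · rfl
      · exact (h3 h5).symm
  · rintro s ⟨-, hc, -, hm⟩
    refine halts_block_nil ⟨hc, ?_⟩
    ext a
    rw [hm, memOf]
    simp

theorem headerProgram_halts (hl : Layout w k N M U B) (hs : Ctx N M U B ω s)
    (hm : s.mem = memOf B [] X) :
    (headerProgram k).Halts w 20 (Writing N M U B ω X [(k + 1) * M, 0, M]) s := by
  have hlt := hl.lt_word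
  have hkB := hl.k_le
  have hMB : (k + 1) * M ≤ B := hl.mul_le (by omega) hl.M_le
  refine Program.Halts.mono (T := 0 + 1 + 1 + 1 + 1 + 1 + 1 + 1 + 1 + 1 + 1)
    ?_ (by omega) (fun _ h => h)
  refine halts_const 10 (k + 1) (by omega) ?_
  refine halts_times 11 10 2 ((k + 1) * M) (by simp [hs.reg2]) (by omega) ?_
  refine halts_const 7 0 (by omega) ?_
  have h0 : Writing N M U B ω X [] (((s.put 10 (k + 1)).put 11 ((k + 1) * M)).put 7 0) :=
    ⟨((hs.put _ _ (by omega)).put _ _ (by omega)).put _ _ (by omega), by simp, by simp [hm]⟩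
  refine halts_push hl 11 ((k + 1) * M) (by simp) h0 (by simp; omega) fun s1 h1 _ => ?_
  refine halts_push hl 0 0 (by simp [h1.ctx.reg0]) h1 (by simp; omega) fun s2 h2 _ => ?_
  refine halts_push hl 2 M (by simp [h2.ctx.reg2]) h2 (by simp; omega) fun s3 h3 _ => ?_
  exact halts_block_nil h3

theorem digitProgram_halts (hl : Layout w k N M U B) (dst d u : ℕ) (hdst : 9 < dst ∧ dst < 19)
    (hu : u < U) (h8 : s.reg 8 = u) (hs : Writing N M U B ω X L s) :
    (digitProgram dst d).Halts w (2 * d + 4) (fun s' => Writing N M U B ω X L s' ∧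
      s'.reg dst = digit N u d ∧ ∀ r, r ≠ dst → s'.reg r = s.reg r) s := by
  have hlt := hl.lt_word
  have hU := hl.U_le
  refine Program.Halts.mono (T := ((0 + 1 + 1) * d + 1) + (0 + 1 + 1) + 1)
    ?_ (by omega) (fun _ h => h)
  refine halts_plus dst 8 0 u (by simp [h8, hs.ctx.reg0]) (by omega) ?_
  refine halts_block_cons (T := (0 + 1 + 1) * d + 1) (T' := 2) ?_
  refine (halts_rep (fun i s' => Writing N M U B ω X L s' ∧ s'.reg dst = u / N ^ i ∧
    ∀ r, r ≠ dst → s'.reg r = s.reg r) d ?_ ?_).mono le_rfl ?_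
  · rintro i - s' ⟨h1, h2, h3⟩
    have h4 : u / N ^ (i + 1) ≤ u := Nat.div_le_self _ _
    refine halts_quot dst dst 1 (u / N ^ (i + 1))
      (by rw [h2, h1.ctx.reg1, Nat.div_div_eq_div_mul, pow_succ]) (by omega) ?_
    refine halts_block_nil ⟨h1.put _ _ (by omega), by simp, fun r hr => ?_⟩
    rw [State.put_reg, if_neg hr, h3 r hr]
  · refine ⟨hs.put _ _ (by omega), by simp, fun r hr => ?_⟩
    rw [State.put_reg, if_neg hr]
  · rintro s' ⟨h1, h2, h3⟩
    have h4 : digit N u d ≤ u := (Nat.mod_le _ _).trans (Nat.div_le_self _ _)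
    refine halts_rem dst dst 1 (digit N u d) (by rw [h2, h1.ctx.reg1]; rfl) (by omega) ?_
    refine halts_block_nil ⟨h1.put _ _ (by omega), by simp, fun r hr => ?_⟩
    rw [State.put_reg, if_neg hr, h3 r hr]

theorem checkProgram_halts (hl : Layout w k N M U B)
    (hX1 : ∀ a, X.getD (1 + a) 0 ≤ 1) (u : ℕ) (t : ℕ × ℕ × ℕ)
    (hu : u < U) (h8 : s.reg 8 = u) (f : ℕ) (h9 : s.reg 9 = f) (hf : f ≤ 1)
    (hs : Writing N M U B ω X L s) :
    (checkProgram t).Halts w (2 * (t.1 + t.2.1 + t.2.2) + 21) (fun s' =>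
      Writing N M U B ω X L s' ∧ s'.reg 8 = u ∧ s'.reg 9 = f * tensorEntry N X u t) s := by
  have hlt := hl.lt_word
  have hN := hl.N_pos
  have hN3 := hl.cube_le
  have hU := hl.U_le
  refine Program.Halts.mono (T := (2 * t.1 + 4) + ((2 * t.2.1 + 4) + ((2 * t.2.2 + 4) +
    (0 + 1 + 1 + 1 + 1 + 1 + 1 + 1 + 1 + 1)))) ?_ (by omega) (fun _ h => h)
  have hd := fun d => digit_lt hN u d
  refine halts_block_cons ?_
  refine (digitProgram_halts hl 10 t.1 u (by omega) hu h8 hs).mono le_rfl ?_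
  rintro s1 ⟨w1, d1, f1⟩
  refine halts_block_cons ?_
  refine (digitProgram_halts hl 11 t.2.1 u (by omega) hu (by rw [f1 8 (by omega), h8]) w1).mono
    le_rfl ?_
  rintro s2 ⟨w2, d2, f2⟩
  refine halts_block_cons ?_
  refine (digitProgram_halts hl 12 t.2.2 u (by omega) hu
    (by rw [f2 8 (by omega), f1 8 (by omega), h8]) w2).mono le_rfl ?_
  rintro s3 ⟨w3, d3, f3⟩
  rw [← f3 11 (by omega)] at d2
  rw [← f2 10 (by omega), ← f3 10 (by omega)] at d1
  rw [← f1 8 (by omega), ← f2 8 (by omega), ← f3 8 (by omega)] at h8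
  rw [← f1 9 (by omega), ← f2 9 (by omega), ← f3 9 (by omega)] at h9
  set x := digit N u t.1 with hx
  set y := digit N u t.2.1 with hy
  set z := digit N u t.2.2 with hz
  have hxN : x < N := hd _
  have hyN : y < N := hd _
  have hzN : z < N := hd _
  have b1 : y + N * z < N * N := by nlinarith
  have b2 : x + N * (y + N * z) < N ^ 3 := by
    rw [show N ^ 3 = N * (N * N) by ring]; nlinarith
  have b3 : N * (y + N * z) < N ^ 3 := by omega
  have b4 : y + N * z ≤ N * (y + N * z) := Nat.le_mul_of_pos_left _ hN
  have hcomm : z * N = N * z := mul_comm _ _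
  have hcomm' : (y + N * z) * N = N * (y + N * z) := mul_comm _ _
  have hle : tensorEntry N X u t ≤ 1 := hX1 _
  refine halts_times 12 12 1 (N * z) (by rw [d3, w3.ctx.reg1, hcomm]) (by omega) ?_
  refine halts_plus 12 12 11 (y + N * z) (by simp [d2]; omega) (by omega) ?_
  refine halts_times 12 12 1 (N * (y + N * z)) (by simp [w3.ctx.reg1, hcomm']) (by omega) ?_
  refine halts_plus 12 12 10 (x + N * (y + N * z)) (by simp [d1]; omega) (by omega) ?_
  refine halts_plus 12 12 5 (1 + (x + N * (y + N * z))) (by simp [w3.ctx.reg5]; omega)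
    (by omega) ?_
  refine halts_plus 12 12 4 (B + (1 + (x + N * (y + N * z)))) (by simp [w3.ctx.reg4]; omega)
    (by omega) ?_
  refine halts_load 10 12 (tensorEntry N X u t) ?_ (by omega) ?_
  · simp only [State.put_mem, State.put_reg, if_true, w3.mem, memOf]
    rw [if_neg (by omega), Nat.add_sub_cancel_left]
    rfl
  have hprod : f * tensorEntry N X u t ≤ 1 := Nat.mul_le_mul hf hle
  refine halts_times 9 9 10 (f * tensorEntry N X u t) (by simp [h9]) (by omega) ?_
  refine halts_block_nil ⟨?_, by simp [h8], by simp⟩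
  exact (((((((w3.put _ _ (by omega)).put _ _ (by omega)).put _ _ (by omega)).put _ _
    (by omega)).put _ _ (by omega)).put _ _ (by omega)).put _ _ (by omega)).put _ _ (by omega)

theorem mem_digitTriples {a b c : ℕ} : (a, b, c) ∈ digitTriples k ↔
    (a < k - 1 ∧ b < k - 1 ∧ c < k - 1) ∧ a ≠ b ∧ a ≠ c ∧ b ≠ c := by
  simp [digitTriples]

theorem checkPrograms_halts (hl : Layout w k N M U B) (hX1 : ∀ a, X.getD (1 + a) 0 ≤ 1) (u : ℕ)
    (l : List (ℕ × ℕ × ℕ)) (hlk : ∀ t ∈ l, t.1 + t.2.1 + t.2.2 ≤ 3 * k)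
    (hu : u < U) (h8 : s.reg 8 = u) (f : ℕ) (h9 : s.reg 9 = f) (hf : f ≤ 1)
    (hs : Writing N M U B ω X L s) :
    (Program.block (l.map checkProgram)).Halts w ((6 * k + 21) * l.length + 1) (fun s' =>
      Writing N M U B ω X L s' ∧ s'.reg 8 = u ∧
        s'.reg 9 = f * if ∀ t ∈ l, tensorEntry N X u t = 1 then 1 else 0) s := by
  induction l generalizing s f with
  | nil => exact halts_block_nil ⟨hs, h8, by simp [h9]⟩
  | cons t l ih =>
    have hle : tensorEntry N X u t ≤ 1 := hX1 _
    refine Program.Halts.mono (T := (6 * k + 21) + ((6 * k + 21) * l.length + 1)) ?_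
      (by rw [List.length_cons, Nat.mul_succ]; omega) (fun _ h => h)
    refine halts_block_cons ?_
    have ht := hlk t (by simp)
    refine (checkProgram_halts hl hX1 u t hu h8 f h9 hf hs).mono (by omega) ?_
    rintro s' ⟨h1, h2, h3⟩
    refine (ih (fun t ht => hlk t (by simp [ht])) h2 _ h3 (Nat.mul_le_mul hf hle) h1).mono
      le_rfl ?_
    rintro s'' ⟨h4, h5, h6⟩
    refine ⟨h4, h5, ?_⟩
    rw [h6, mul_assoc]
    congr 1
    by_cases h7 : tensorEntry N X u t = 1
    · simp only [List.forall_mem_cons, h7, true_and, one_mul]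
    · have h8 : tensorEntry N X u t = 0 := by omega
      simp [h8]

theorem emitProgram_halts (hl : Layout w k N M U B) (u : ℕ) (hu : u < U) (h8 : s.reg 8 = u)
    (hs : Writing N M U B ω X L s) (hL : L.length + 2 * k ≤ B) :
    (emitProgram k).Halts w (8 * k + 5) (fun s' =>
      Writing N M U B ω X
        (L ++ (List.range k).flatMap fun i => [i * M + u % M, (i + 1) * M + u / N]) s' ∧
      s'.reg 8 = u) s := by
  have hlt := hl.lt_word
  have hUB := hl.U_le
  have hMU := hl.M_le
  have h1 : u % M < M := Nat.mod_lt _ hl.M_pos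
  have h2 : u / N < M := by
    rw [Nat.div_lt_iff_lt_mul hl.N_pos, ← hl.U_eq]; exact hu
  have hkM : (k + 1) * M ≤ B := hl.mul_le (by omega) hl.M_le
  refine Program.Halts.mono (T := (8 * k + 1 + 1) + 1 + 1 + 1) ?_ (by omega) (fun _ h => h)
  refine halts_rem 17 8 2 (u % M) (by rw [h8, hs.ctx.reg2]) (by omega) ?_
  refine halts_quot 18 8 1 (u / N) (by simp [h8, hs.ctx.reg1]) (by omega) ?_
  refine halts_const 15 0 (by omega) ?_
  refine halts_block_cons (T := 8 * k + 1) (T' := 1) ?_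
  refine (halts_rep (fun i s' => Writing N M U B ω X
        (L ++ (List.range i).flatMap fun i => [i * M + u % M, (i + 1) * M + u / N]) s' ∧
      s'.reg 8 = u ∧ s'.reg 17 = u % M ∧ s'.reg 18 = u / N ∧ s'.reg 15 = i * M) k ?_ ?_).mono
      le_rfl ?_
  · rintro i hi s ⟨hw, h8, h17, h18, h15⟩
    have hiM : (i + 1) * M ≤ k * M := Nat.mul_le_mul_right _ hi
    have hkM' : (k + 1) * M = k * M + M := Nat.succ_mul _ _
    have hiM' : (i + 1) * M = i * M + M := Nat.succ_mul _ _
    have hlen : ∀ i, (((List.range i).flatMap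
        fun i => [i * M + u % M, (i + 1) * M + u / N])).length = 2 * i := by
      intro i; simp [List.length_flatMap, mul_comm]
    refine halts_plus 10 15 17 (i * M + u % M) (by rw [h15, h17]) (by omega) ?_
    refine halts_push hl 10 (i * M + u % M) (by simp) (hw.put _ _ (by omega))
      (by rw [List.length_append, hlen]; omega) fun s1 w1 f1 => ?_
    refine halts_plus 15 15 2 ((i + 1) * M)
      (by rw [w1.ctx.reg2, f1 15 (by omega)]; simp [h15, hiM']) (by omega) ?_
    refine halts_plus 10 15 18 ((i + 1) * M + u / N)
      (by simp [f1, h18]) (by omega) ?_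
    refine halts_push hl 10 ((i + 1) * M + u / N) (by simp)
      ((w1.put _ _ (by omega)).put _ _ (by omega))
      (by simp only [List.length_append, hlen, List.length_singleton]; omega) fun s2 w2 f2 => ?_
    refine halts_block_nil ⟨?_, by simp [f2, f1, h8], by simp [f2, f1, h17],
      by simp [f2, f1, h18], by simp [f2]⟩
    simpa [List.range_succ] using w2
  · exact ⟨by simpa using ((hs.put _ _ (by omega)).put _ _ (by omega)).put _ _ (by omega),
      by simp [h8], by simp, by simp, by simp⟩
  · rintro s' ⟨h1, h2, -⟩
    exact halts_block_nil ⟨h1, h2⟩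

/-- The time for one candidate. -/
def edgeTime (k : ℕ) : ℕ := (6 * k + 21) * (digitTriples k).length + 8 * k + 11

theorem length_edgeWords_le (u : ℕ) : (edgeWords k N M X u).length ≤ 2 * k := by
  unfold edgeWords
  split_ifs <;> simp [List.length_flatMap, mul_comm]

theorem length_allEdgeWords_le (k N M U : ℕ) (X : List ℕ) :
    (allEdgeWords k N M U X).length ≤ 2 * k * U := by
  rw [allEdgeWords, List.length_flatMap]
  have h := List.sum_le_card_nsmul ((List.range U).reverse.map
    fun u => (edgeWords k N M X u).length) (2 * k) (by
      intro x hx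
      obtain ⟨u, -, rfl⟩ := List.mem_map.1 hx
      exact length_edgeWords_le u)
  simpa [mul_comm] using h

theorem length_allPairWords (k M : ℕ) : (allPairWords k M).length = 2 * M := by
  simp [allPairWords, List.length_flatMap, pairWords, mul_comm]

theorem edgeProgram_halts (hl : Layout w k N M U B) (hX1 : ∀ a, X.getD (1 + a) 0 ≤ 1)
    (hs : Writing N M U B ω X L s) (hL : L.length + 2 * k * U ≤ B) :
    (edgeProgram k).Halts w (edgeTime k * U + 4)
      (Writing N M U B ω X (L ++ allEdgeWords k N M U X)) s := by
  have hlt := hl.lt_word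
  have hUB := hl.U_le
  have hlen := length_allEdgeWords_le k N M U X
  refine Program.Halts.mono (T := (edgeTime k * U + 1 + 1) + 1) ?_ (by omega) (fun _ h => h)
  refine halts_plus 8 3 0 U (by simp [hs.ctx.reg3, hs.ctx.reg0]) (by omega) ?_
  refine halts_block_cons (T := edgeTime k * U + 1) (T' := 1) ?_
  refine (halts_countdown (T := edgeTime k - 1) 8 (fun j s => s.reg 8 = j ∧ j ≤ U ∧
    ∃ L', Writing N M U B ω X L' s ∧ L' ++ (List.range j).reverse.flatMap (edgeWords k N M X) =
      L ++ allEdgeWords k N M U X) (fun j s h => h.1) ?_ U ?_).mono ?_ ?_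
  · rintro u s ⟨h8, hu, L', hw, hL'⟩
    have hlenL : L'.length + (edgeWords k N M X u).length ≤ B := by
      have h := congrArg List.length hL'
      simp only [List.range_succ, List.reverse_append, List.length_append,
        List.reverse_singleton, List.singleton_append, List.flatMap_cons] at h
      omega
    refine Program.Halts.mono (T := ((6 * k + 21) * (digitTriples k).length + 1 +
      (8 * k + 5 + 1 + 1)) + 1 + 1) ?_ (by unfold edgeTime; omega) (fun _ h => h)
    refine halts_minus 8 8 5 u (by rw [h8, hw.ctx.reg5]) (by omega) ?_
    refine halts_const 9 1 (by omega) ?_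
    refine halts_block_cons (T := (6 * k + 21) * (digitTriples k).length + 1)
      (T' := 8 * k + 5 + 1 + 1) ?_
    refine (checkPrograms_halts hl hX1 u (digitTriples k) ?_ (by omega) (by simp) 1 (by simp)
      le_rfl ((hw.put _ _ (by omega)).put _ _ (by omega))).mono le_rfl ?_
    · intro t ht
      obtain ⟨a, b, c⟩ := t
      have h := mem_digitTriples.1 ht
      dsimp only
      omega
    rintro s' ⟨h1, h2, h3⟩
    rw [one_mul] at h3
    refine halts_block_cons (T := 8 * k + 5 + 1) (T' := 1) ?_
    have hfinal : ∀ s'', Writing N M U B ω X (L' ++ edgeWords k N M X u) s'' ∧ s''.reg 8 = u →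
        (Program.block []).Halts w 1 (fun s => s.reg 8 = u ∧ u ≤ U ∧
          ∃ L', Writing N M U B ω X L' s ∧
            L' ++ (List.range u).reverse.flatMap (edgeWords k N M X) =
              L ++ allEdgeWords k N M U X) s'' := by
      rintro s'' ⟨h4, h5⟩
      refine halts_block_nil ⟨h5, by omega, _, h4, ?_⟩
      rw [← hL']
      simp [List.range_succ]
    refine halts_ite 9 (fun h => ?_) (fun h => ?_)
    · have hgood : AllTriples k N X u := by
        by_contra hc
        exact h (h3.trans (if_neg hc))
      have hew : edgeWords k N M X u =
          (List.range k).flatMap fun i => [i * M + u % M, (i + 1) * M + u / N] := if_pos hgood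
      have hlen2 : (edgeWords k N M X u).length = 2 * k := by
        rw [hew]; simp [List.length_flatMap, mul_comm]
      refine (emitProgram_halts hl u (by omega) h2 h1 (by omega)).mono le_rfl fun s'' hs'' => ?_
      rw [← hew] at hs''
      exact hfinal s'' hs''
    · have hbad : ¬ AllTriples k N X u := by
        intro hc
        have := h3.symm.trans h
        rw [if_pos (show ∀ t ∈ digitTriples k, tensorEntry N X u t = 1 from hc)] at this
        omega
      refine halts_skip (hfinal _ ⟨?_, h2⟩)
      rw [edgeWords, if_neg hbad, List.append_nil]
      exact h1
  · exact ⟨by simp, le_rfl, L, hs.put _ _ (by omega), rfl⟩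
  · rw [Nat.sub_add_cancel (by unfold edgeTime; omega)]
  · rintro s' ⟨-, -, L', hw, hL'⟩
    simp only [List.range_zero, List.reverse_nil, List.flatMap_nil, List.append_nil] at hL'
    exact halts_block_nil (hL' ▸ hw)

theorem countProgram_halts (hl : Layout w k N M U B) {E : List ℕ} {x y : ℕ}
    (hs : Writing N M U B ω X ([x, 0, y] ++ E) s) (hE : 3 + E.length ≤ B) :
    countProgram.Halts w 6 (Writing N M U B ω X ([x, E.length / 2, y] ++ E)) s := by
  have hlt := hl.lt_word
  have hkB := hl.k_le
  have hp : s.reg 7 = E.length + 3 := by rw [hs.ptr]; simp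
  refine halts_const 10 3 (by omega) ?_
  refine halts_minus 10 7 10 E.length (by simp [hp]) (by simp [hp]; omega) ?_
  refine halts_const 11 2 (by omega) ?_
  refine halts_quot 10 10 11 (E.length / 2) (by simp) (by omega) ?_
  refine halts_store 5 10 1 (E.length / 2) (by simp [hs.ctx.reg5]) (by simp) ?_
  refine halts_block_nil ⟨((((hs.ctx.put _ _ (by omega)).put _ _ (by omega)).put _ _
    (by omega)).put _ _ (by omega)).setMem _ _, by simp [hp], ?_⟩
  simp only [State.setMem_mem, State.put_mem, hs.mem]
  rw [memOf_set (by simp) (by simp; omega)]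
  rfl

theorem pairProgram_halts (hl : Layout w k N M U B)
    (hs : Writing N M U B ω X L s) (hL : L.length + 2 * M ≤ B) :
    (pairProgram k).Halts w (8 * M + 5) (Writing N M U B ω X (L ++ allPairWords k M)) s := by
  have hlt := hl.lt_word
  have hUB := hl.U_le
  have hMU := hl.M_le
  have hkB := hl.k_le
  have hkM : (k + 1) * M ≤ B := hl.mul_le (by omega) hl.M_le
  have hkM' : (k + 1) * M = k * M + M := Nat.succ_mul _ _
  have hlen := length_allPairWords k M
  refine Program.Halts.mono (T := ((0 + 1 + 1 + 1 + 1 + 1 + 1 + 1 + 1) * M + 1 + 1) + 1 + 1 + 1) ?_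
    (by omega) (fun _ h => h)
  refine halts_plus 8 2 0 M (by simp [hs.ctx.reg2, hs.ctx.reg0]) (by omega) ?_
  refine halts_const 10 k (by omega) ?_
  refine halts_times 15 10 2 (k * M) (by simp [hs.ctx.reg2]) (by omega) ?_
  refine halts_block_cons (T := (0 + 1 + 1 + 1 + 1 + 1 + 1 + 1 + 1) * M + 1) (T' := 1) ?_
  refine (halts_countdown 8 (fun j s => s.reg 8 = j ∧ j ≤ M ∧ s.reg 15 = k * M ∧
    ∃ L', Writing N M U B ω X L' s ∧ L' ++ (List.range j).reverse.flatMap (pairWords k M) =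
      L ++ allPairWords k M) (fun j s h => h.1) ?_ M ?_).mono le_rfl ?_
  · rintro y s ⟨h8, hy, h15, L', hw, hL'⟩
    have hlenL : L'.length + 2 ≤ B := by
      have h := congrArg List.length hL'
      simp only [List.range_succ, List.reverse_append, List.length_append, pairWords,
        List.reverse_singleton, List.singleton_append, List.flatMap_cons, List.length_cons] at h
      omega
    refine halts_minus 8 8 5 y (by rw [h8, hw.ctx.reg5]) (by omega) ?_
    refine halts_push hl 8 y (by simp) (hw.put _ _ (by omega)) (by omega) fun s1 w1 f1 => ?_
    refine halts_plus 10 15 8 (k * M + y) (by simp [f1, h15]) (by omega) ?_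
    refine halts_push hl 10 (k * M + y) (by simp) (w1.put _ _ (by omega)) (by simp; omega)
      fun s2 w2 f2 => ?_
    refine halts_block_nil ⟨by simp [f2, f1], by omega, by simp [f2, f1, h15], _, w2, ?_⟩
    rw [← hL']
    simp [List.range_succ, pairWords]
  · exact ⟨by simp, le_rfl, by simp, L,
      ((hs.put _ _ (by omega)).put _ _ (by omega)).put _ _ (by omega), rfl⟩
  · rintro s' ⟨-, -, -, L', hw, hL'⟩
    simp only [List.range_zero, List.reverse_nil, List.flatMap_nil, List.append_nil] at hL'
    exact halts_block_nil (hL' ▸ hw)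

theorem clearProgram_halts (hl : Layout w k N M U B) (hX : X.length = N ^ 3 + 1)
    (hs : Writing N M U B ω X L s) (hL : L.length ≤ B) :
    clearProgram.Halts w (5 * (N ^ 3 + 1) + 3)
      (fun s => Ctx N M U B ω s ∧ s.mem = fun a => L.getD a 0) s := by
  have hlt := hl.lt_word
  have hU := hl.U_le
  have hN3 := hl.cube_le
  have hpos := hl.cube_pos
  refine Program.Halts.mono
    (T := ((0 + 1 + 1 + 1 + 1 + 1) * (N ^ 3 + 1) + 1) + (0 + 1) + 1)
    ?_ (by omega) (fun _ h => h)
  refine halts_plus 8 6 0 (N ^ 3 + 1) (by simp [hs.ctx.reg6, hs.ctx.reg0]) (by omega) ?_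
  refine halts_block_cons (T := (0 + 1 + 1 + 1 + 1 + 1) * (N ^ 3 + 1) + 1) (T' := 1) ?_
  refine (halts_countdown 8 (fun j s => s.reg 8 = j ∧ Ctx N M U B ω s ∧ j ≤ N ^ 3 + 1 ∧
    ∀ a, s.mem a = if a < B then L.getD a 0 else
      (if a - B < j then X.getD (a - B) 0 else 0)) (fun j s h => h.1) ?_ (N ^ 3 + 1) ?_).mono
      le_rfl ?_
  · rintro j s ⟨h8, hc, hj, hm⟩
    refine halts_minus 8 8 5 j (by rw [h8, hc.reg5]) (by omega) ?_
    refine halts_plus 10 4 8 (B + j) (by simp [hc.reg4]) (by omega) ?_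
    refine halts_store 10 0 (B + j) 0 (by simp) (by simp [hc.reg0]) ?_
    refine halts_block_nil ⟨by simp, ?_, by omega, fun a => ?_⟩
    · exact ((hc.put _ _ (by omega)).put _ _ (by omega)).setMem _ _
    · simp only [State.setMem_mem, State.put_mem, Function.update_apply, hm]
      by_cases h2 : a = B + j
      · subst h2
        rw [if_pos rfl, if_neg (by omega), if_neg (by omega)]
      · rw [if_neg h2]
        split_ifs <;> first | rfl | omega
  · refine ⟨by simp, hs.ctx.put _ _ (by omega), le_rfl, fun a => ?_⟩
    rw [State.put_mem, hs.mem, memOf]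
    have h3 : ¬ a - B < N ^ 3 + 1 → X.getD (a - B) 0 = 0 :=
      fun h => List.getD_eq_default _ _ (by omega)
    split_ifs with h4 h5
    · rfl
    · rfl
    · exact h3 h5
  · rintro s ⟨-, hc, -, hm⟩
    refine halts_block_nil ⟨hc, ?_⟩
    ext a
    rw [hm]
    by_cases h : a < B
    · rw [if_pos h]
    · rw [if_neg h, if_neg (by omega), List.getD_eq_default _ _ (by omega)]

theorem resetProgram_halts (hs : Ctx N M U B ω s) :
    resetProgram.Halts w 20 (fun s' => s' = ⟨fun _ => 0, s.mem, ω⟩) s := by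
  have key : ∀ (l : List ℕ) (s : State), (Program.block (l.map fun r => .const r 0)).Halts w
      (l.length + 1) (fun s' => s'.mem = s.mem ∧ s'.coins = s.coins ∧
        ∀ r, s'.reg r = if r ∈ l then 0 else s.reg r) s := by
    intro l
    induction l with
    | nil => exact fun s => halts_block_nil ⟨rfl, rfl, fun r => by simp⟩
    | cons r l ih =>
      intro s
      refine halts_const r 0 (by positivity) ((ih (s.put r 0)).mono le_rfl ?_)
      rintro s' ⟨h1, h2, h3⟩
      refine ⟨h1, h2, fun r' => ?_⟩
      rw [h3, State.put_reg]
      by_cases hr : r' = r <;> simp [hr]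
  refine (key (List.range 19) s).mono (by simp) ?_
  rintro ⟨reg, mem, coins⟩ ⟨h1, h2, h3⟩
  have h4 : reg = fun _ => 0 := by
    ext r
    refine (h3 r).trans ?_
    split_ifs with h
    · rfl
    · exact hs.high r (by simpa using h)
  simp only [State.mk.injEq]
  exact ⟨h4, h1, h2.trans hs.coins⟩

end Correctness

/-- The program that replaces the adjacency tensor by the encoding of the layered graph. -/
def buildProgram (k : ℕ) : Program :=
  .block [setupProgram k, moveProgram, headerProgram k, edgeProgram k, countProgram,
    pairProgram k, clearProgram, resetProgram]

/-- The encoding of the layered graph. -/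
def layeredWords (k N M U : ℕ) (X : List ℕ) : List ℕ :=
  [(k + 1) * M, (allEdgeWords k N M U X).length / 2, M] ++ allEdgeWords k N M U X ++
    allPairWords k M

theorem buildProgram_deterministic (k : ℕ) : (buildProgram k).Deterministic := by
  refine Program.block_deterministic ?_
  have hd : ∀ dst d, (digitProgram dst d).Deterministic := fun dst d =>
    ⟨trivial, Program.rep_deterministic ⟨trivial, trivial⟩, trivial, trivial⟩
  have hc : ∀ t, (checkProgram t).Deterministic := fun t =>
    ⟨hd _ _, hd _ _, hd _ _, trivial, trivial, trivial, trivial, trivial, trivial, trivial, trivial,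
      trivial⟩
  simp only [List.mem_cons, List.not_mem_nil, or_false]
  rintro p (rfl | rfl | rfl | rfl | rfl | rfl | rfl | rfl)
  · exact ⟨trivial, trivial, trivial, Program.rep_deterministic ⟨trivial, trivial⟩, trivial,
      trivial, trivial, trivial, trivial, trivial, trivial⟩
  · simp [moveProgram, Program.block, Program.Deterministic]
  · simp [headerProgram, Program.block, Program.Deterministic]
  · refine ⟨trivial, ⟨trivial, trivial, Program.block_deterministic ?_, ⟨?_, trivial⟩, trivial⟩,
      trivial⟩
    · intro p hp
      obtain ⟨t, -, rfl⟩ := List.mem_map.1 hp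
      exact hc t
    · refine ⟨trivial, trivial, trivial, Program.rep_deterministic ?_, trivial⟩
      simp [Program.block, Program.Deterministic]
  · simp [countProgram, Program.block, Program.Deterministic]
  · simp [pairProgram, Program.block, Program.Deterministic]
  · simp [clearProgram, Program.block, Program.Deterministic]
  · refine Program.block_deterministic fun p hp => ?_
    obtain ⟨t, -, rfl⟩ := List.mem_map.1 hp
    trivial

theorem buildProgram_halts {w k N M U B : ℕ} {X : List ℕ} (hl : Layout w k N M U B)
    (hX : X.length = N ^ 3 + 1) (hX0 : X.getD 0 0 = N) (hX1 : ∀ a, X.getD (1 + a) 0 ≤ 1)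
    (ω : ℕ → Bool) :
    (buildProgram k).Halts w ((edgeTime k + 2 * k + 200) * U)
      (fun s => s = ⟨fun _ => 0, fun a => (layeredWords k N M U X).getD a 0, ω⟩)
      (State.init w X ω) := by
  have hlt := hl.lt_word
  have hU := hl.U_le
  have hMU := hl.M_le
  have hM := hl.M_pos
  have hk := hl.k_ge
  have hN3 := hl.cube_le
  have hpos := hl.cube_pos
  have hNle : N ≤ N ^ 3 := Nat.le_self_pow (by omega) _
  have hXw : ∀ a, X.getD a 0 < 2 ^ w := by
    intro a
    rcases a with _ | a
    · rw [hX0]; omega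
    · have := hX1 a
      rw [add_comm] at this
      omega
  have hB : 5 * U + 2 * k * U = B := by rw [hl.B_eq]; ring
  have hlenE := length_allEdgeWords_le k N M U X
  have hlenP := length_allPairWords k M
  refine Program.Halts.mono (T := (2 * k + 20) + ((7 * (N ^ 3 + 1) + 3) + (20 +
    ((edgeTime k * U + 4) + (6 + ((8 * M + 5) + ((5 * (N ^ 3 + 1) + 3) + (20 + 1)))))))) ?_ ?_
    (fun _ h => h)
  swap
  · have h1 : (edgeTime k + 2 * k + 200) * U = edgeTime k * U + 2 * k * U + 200 * U := by ring
    have h2 : 2 * k ≤ 2 * k * U := Nat.le_mul_of_pos_right _ (by omega)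
    rw [h1]
    omega
  refine halts_block_cons ((setupProgram_halts hl hX0 hXw).mono le_rfl ?_)
  rintro s1 ⟨c1, m1⟩
  refine halts_block_cons ((moveProgram_halts hl hX hXw c1 m1).mono le_rfl ?_)
  rintro s2 ⟨c2, m2⟩
  refine halts_block_cons ((headerProgram_halts hl c2 m2).mono le_rfl ?_)
  intro s3 w3
  refine halts_block_cons ((edgeProgram_halts hl hX1 w3 (by simp; omega)).mono le_rfl ?_)
  intro s4 w4
  refine halts_block_cons ((countProgram_halts hl w4 (by omega)).mono le_rfl ?_)
  intro s5 w5
  refine halts_block_cons ((pairProgram_halts hl w5 (by simp; omega)).mono le_rfl ?_)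
  intro s6 w6
  refine halts_block_cons ((clearProgram_halts hl hX w6 (by simp; omega)).mono le_rfl ?_)
  rintro s7 ⟨c7, m7⟩
  refine halts_block_cons ((resetProgram_halts c7).mono le_rfl ?_)
  rintro s8 rfl
  refine halts_block_nil ?_
  rw [m7]
  rfl

/-! ### Digits -/

theorem digit_mod_pow {N u d e : ℕ} (h : d < e) : digit N (u % N ^ e) d = digit N u d := by
  unfold digit
  obtain ⟨c, rfl⟩ := Nat.exists_eq_add_of_lt h
  rw [show d + c + 1 = d + (c + 1) by ring, pow_add, Nat.mod_mul_right_div_self, pow_succ',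
    Nat.mod_mul_right_mod]

theorem digit_div (N u d : ℕ) : digit N (u / N) d = digit N u (d + 1) := by
  unfold digit
  rw [Nat.div_div_eq_div_mul, pow_succ']

/-- The number with digits `f 0, …, f (n - 1)` in base `N`. -/
def ofDigitFun (N : ℕ) : ℕ → (ℕ → ℕ) → ℕ
  | 0, _ => 0
  | n + 1, f => f 0 + N * ofDigitFun N n (fun i => f (i + 1))

theorem ofDigitFun_lt {N : ℕ} {n : ℕ} {f : ℕ → ℕ} (hf : ∀ i, f i < N) :
    ofDigitFun N n f < N ^ n := by
  induction n generalizing f with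
  | zero => simp [ofDigitFun]
  | succ n ih =>
    have h1 := ih (f := fun i => f (i + 1)) fun i => hf _
    have h2 := hf 0
    rw [ofDigitFun, pow_succ']
    nlinarith

theorem ofDigitFun_succ_div {N : ℕ} (n : ℕ) {f : ℕ → ℕ} (hf : ∀ i, f i < N) :
    ofDigitFun N (n + 1) f / N = ofDigitFun N n (fun i => f (i + 1)) := by
  have h2 := hf 0
  rw [ofDigitFun, Nat.add_mul_div_left _ _ (by omega), Nat.div_eq_of_lt h2, zero_add]

theorem ofDigitFun_succ_mod {N : ℕ} (n : ℕ) {f : ℕ → ℕ} (hf : ∀ i, f i < N) :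
    ofDigitFun N (n + 1) f % N ^ n = ofDigitFun N n f := by
  induction n generalizing f with
  | zero => simp [ofDigitFun, Nat.mod_one]
  | succ n ih =>
    have h1 := ih (f := fun i => f (i + 1)) fun i => hf _
    have h2 := hf 0
    rw [ofDigitFun, pow_succ', Nat.mod_mul, Nat.add_mul_mod_self_left, Nat.mod_eq_of_lt h2,
      Nat.add_mul_div_left _ _ (by omega), Nat.div_eq_of_lt h2, zero_add, h1]
    rfl

theorem digit_ofDigitFun {N n d : ℕ} {f : ℕ → ℕ} (hf : ∀ i, f i < N) (hd : d < n) :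
    digit N (ofDigitFun N n f) d = f d := by
  induction n generalizing f d with
  | zero => omega
  | succ n ih =>
    rcases d with _ | d
    · have h2 := hf 0
      rw [digit, pow_zero, Nat.div_one, ofDigitFun, Nat.add_mul_mod_self_left,
        Nat.mod_eq_of_lt h2]
    · rw [← digit_div, ofDigitFun_succ_div n hf, ih (fun i => hf _) (by omega)]

/-! ### Walks in the layered graph -/

/-- A step of a walk in the layered graph, from word `y` in layer `i` to word `y'` in layer `i'`;
the words have `k - 2` digits in base `N`, and the edges belong to the numbers with the property
`good`. -/
def LayerStep (k N : ℕ) (good : ℕ → Prop) (i y i' y' : ℕ) : Prop :=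
  ∃ u, good u ∧ ((i < k ∧ i' = i + 1 ∧ y = u % N ^ (k - 2) ∧ y' = u / N) ∨
    (i' < k ∧ i = i' + 1 ∧ y' = u % N ^ (k - 2) ∧ y = u / N))

/-- A walk with `n` steps in the layered graph, given by the layers and the words, from a word in
the first layer to the same word in the last one. -/
structure LayerWalk (k N : ℕ) (good : ℕ → Prop) (n : ℕ) (lay word : ℕ → ℕ) : Prop where
  k_ge : 4 ≤ k
  start : lay 0 = 0
  finish : lay n = k
  closed : word 0 = word n
  step : ∀ t < n, LayerStep k N good (lay t) (word t) (lay (t + 1)) (word (t + 1))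

/-- The times before `T` at which the walk passes between the layers `s` and `s + 1`. -/
def crossings (lay : ℕ → ℕ) (s T : ℕ) : Finset ℕ :=
  (Finset.range T).filter fun t => min (lay t) (lay (t + 1)) = s

namespace LayerWalk

variable {k N n : ℕ} {good : ℕ → Prop} {lay word : ℕ → ℕ}

theorem adjacent (W : LayerWalk k N good n lay word) {t : ℕ} (ht : t < n) :
    (lay t < k ∧ lay (t + 1) = lay t + 1) ∨ (lay (t + 1) < k ∧ lay t = lay (t + 1) + 1) := by
  obtain ⟨u, -, h | h⟩ := W.step t ht
  · exact Or.inl ⟨h.1, h.2.1⟩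
  · exact Or.inr ⟨h.1, h.2.1⟩

theorem le_k (W : LayerWalk k N good n lay word) {t : ℕ} (ht : t ≤ n) : lay t ≤ k := by
  rcases ht.lt_or_eq with h | rfl
  · have := W.adjacent h; omega
  · exact W.finish.le

theorem card_crossings_mod (W : LayerWalk k N good n lay word) (s : ℕ) {T : ℕ} (hT : T ≤ n) :
    (crossings lay s T).card % 2 = if s < lay T then 1 else 0 := by
  induction T with
  | zero => simp [crossings, W.start]
  | succ T ih =>
    have h1 := ih (by omega)
    have h2 := W.adjacent (t := T) (by omega)
    have h3 : (crossings lay s (T + 1)).card = (crossings lay s T).card +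
        if min (lay T) (lay (T + 1)) = s then 1 else 0 := by
      unfold crossings
      rw [Finset.range_add_one, Finset.filter_insert]
      split_ifs
      · rw [Finset.card_insert_of_notMem (by simp)]
      · rfl
    rw [h3]
    split_ifs at h1 ⊢ <;> omega

/-- The levels that are passed exactly once. -/
def singleLevels (k : ℕ) (lay : ℕ → ℕ) (n : ℕ) : Finset ℕ :=
  (Finset.range k).filter fun s => (crossings lay s n).card = 1

theorem sum_card_crossings (W : LayerWalk k N good n lay word) :
    ∑ s ∈ Finset.range k, (crossings lay s n).card = n := by
  have h := Finset.card_eq_sum_card_fiberwise (s := Finset.range n) (t := Finset.range k)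
    (f := fun t => min (lay t) (lay (t + 1))) (by
      intro t ht
      have h1 := W.adjacent (t := t) (by simpa using ht)
      simp only [Finset.coe_range, Set.mem_Iio]
      omega)
  rw [Finset.card_range] at h
  exact h.symm

theorem four_le_card_singleLevels (W : LayerWalk k N good n lay word) (hn : n < 3 * k - 6) :
    4 ≤ (singleLevels k lay n).card := by
  have hk := W.k_ge
  have h1 : ∀ s ∈ Finset.range k,
      3 ≤ (crossings lay s n).card + 2 * if (crossings lay s n).card = 1 then 1 else 0 := by
    intro s hs
    have h2 := W.card_crossings_mod s le_rfl
    rw [W.finish, if_pos (Finset.mem_range.1 hs)] at h2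
    split_ifs <;> omega
  have h3 := Finset.card_nsmul_le_sum _ _ _ h1
  rw [Finset.sum_add_distrib, W.sum_card_crossings, ← Finset.mul_sum, Finset.sum_boole,
    Finset.card_range] at h3
  simp only [smul_eq_mul, Nat.cast_id] at h3
  change _ ≤ n + 2 * (singleLevels k lay n).card at h3
  omega

/-- The step at which a level is passed that is passed only once. -/
theorem exists_single_crossing (W : LayerWalk k N good n lay word) {s : ℕ}
    (hs : s ∈ singleLevels k lay n) :
    ∃ t < n, ∃ u, good u ∧ lay t = s ∧ lay (t + 1) = s + 1 ∧ word t = u % N ^ (k - 2) ∧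
      word (t + 1) = u / N ∧ (∀ t' ≤ t, lay t' ≤ s) ∧ ∀ t' ≤ n, t < t' → s < lay t' := by
  obtain ⟨hsk, hc⟩ := Finset.mem_filter.1 hs
  obtain ⟨t, ht⟩ := Finset.card_eq_one.1 hc
  have hmem : ∀ t', (t' < n ∧ min (lay t') (lay (t' + 1)) = s) ↔ t' = t := by
    intro t'
    have h := Finset.ext_iff.1 ht t'
    simpa [crossings] using h
  obtain ⟨htn, hts⟩ := (hmem t).2 rfl
  have hle : ∀ t' ≤ t, lay t' ≤ s := by
    intro t' ht'
    have h1 := W.card_crossings_mod s (T := t') (by omega)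
    have h2 : crossings lay s t' = ∅ := by
      refine Finset.filter_eq_empty_iff.2 fun x hx h => ?_
      have hx' := Finset.mem_range.1 hx
      have := (hmem x).1 ⟨by omega, h⟩
      omega
    rw [h2] at h1
    by_contra hcon
    rw [if_pos (by omega)] at h1
    simp at h1
  have hlt : ∀ t' ≤ n, t < t' → s < lay t' := by
    intro t' ht' htt'
    have h1 := W.card_crossings_mod s (T := t') ht'
    have h2 : crossings lay s t' = {t} := by
      ext x
      rw [Finset.mem_singleton, ← hmem]
      simp only [crossings, Finset.mem_filter, Finset.mem_range]
      constructor
      · rintro ⟨h3, h4⟩; exact ⟨by omega, h4⟩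
      · rintro ⟨h3, h4⟩
        have := (hmem x).1 ⟨h3, h4⟩
        exact ⟨by omega, h4⟩
    rw [h2] at h1
    by_contra hcon
    rw [if_neg (by omega)] at h1
    simp at h1
  have h1 := hle t le_rfl
  have h2 := hlt (t + 1) (by omega) (by omega)
  obtain ⟨u, hu, h | h⟩ := W.step t htn
  · exact ⟨t, htn, u, hu, by omega, by omega, h.2.2.1, h.2.2.2, hle, hlt⟩
  · omega

/-- The value at a position does not change while the position is available. -/
theorem digit_word_eq (W : LayerWalk k N good n lay word) {p t₀ t₁ : ℕ} (h01 : t₀ ≤ t₁)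
    (h1n : t₁ ≤ n) (hp : ∀ t, t₀ ≤ t → t ≤ t₁ → lay t ≤ p ∧ p + 3 ≤ lay t + k) :
    digit N (word t₀) (p - lay t₀) = digit N (word t₁) (p - lay t₁) := by
  induction t₁, h01 using Nat.le_induction with
  | base => rfl
  | succ t h01 ih =>
    rw [ih (by omega) fun t' h h' => hp t' h (by omega)]
    have h1 := hp t h01 (by omega)
    have h2 := hp (t + 1) (by omega) le_rfl
    obtain ⟨u, -, ⟨-, h3, h4, h5⟩ | ⟨-, h3, h4, h5⟩⟩ := W.step t (by omega)
    · rw [h4, h5, digit_mod_pow (by omega), digit_div]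
      congr 1; omega
    · rw [h4, h5, digit_mod_pow (by omega), digit_div]
      congr 1; omega

/-- The coordinate `j` is not available at level `s`. -/
def Missing (k s j : ℕ) : Prop := j + 1 = s ∨ (s = 0 ∧ j + 1 = k)

/-- The position of the coordinate `j` at level `s`. -/
def position (k s j : ℕ) : ℕ := if s ≤ j then j else j + k

/-- The edges at two levels that are passed only once agree on all coordinates. -/
theorem exists_consistent_edges (W : LayerWalk k N good n lay word) :
    ∃ e : ℕ → ℕ, (∀ s ∈ singleLevels k lay n, good (e s)) ∧
      ∀ s ∈ singleLevels k lay n, ∀ s' ∈ singleLevels k lay n, ∀ j < k,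
        ¬ Missing k s j → ¬ Missing k s' j →
          digit N (e s) (position k s j - s) = digit N (e s') (position k s' j - s') := by
  classical
  have hk := W.k_ge
  choose! t htn e hgood hlay hlay' hword hword' hbefore hafter using
    fun s (hs : s ∈ singleLevels k lay n) => W.exists_single_crossing hs
  refine ⟨e, hgood, ?_⟩
  have key : ∀ s ∈ singleLevels k lay n, ∀ s' ∈ singleLevels k lay n, s < s' → ∀ j < k,
        ¬ Missing k s j → ¬ Missing k s' j →
          digit N (e s) (position k s j - s) = digit N (e s') (position k s' j - s') := by
    intro s hs s' hs' hss' j hj hm hm'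
    have hsk : s' < k := Finset.mem_range.1 (Finset.mem_filter.1 hs').1
    unfold Missing at hm hm'
    have htt' : t s < t s' := by
      by_contra hcon
      have h1 := hbefore s hs (t s') (by omega)
      have h2 := hlay s' hs'
      omega
    have hleft : ∀ s ∈ singleLevels k lay n, ∀ p, s ≤ p → p + 3 ≤ s + k →
        digit N (e s) (p - s) = digit N (word (t s)) (p - lay (t s)) := by
      intro s hs p h1 h2
      rw [hword s hs, digit_mod_pow (by rw [hlay s hs]; omega), hlay s hs]
    have hright : ∀ s ∈ singleLevels k lay n, ∀ p, s < p →
        digit N (e s) (p - s) = digit N (word (t s + 1)) (p - lay (t s + 1)) := by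
      intro s hs p h1
      rw [hword' s hs, digit_div, hlay' s hs]
      congr 1; omega
    have hmiddle : ∀ p, s' ≤ p → p + 2 ≤ s + k →
        digit N (e s) (p - s) = digit N (e s') (p - s') := by
      intro p h1 h2
      rw [hright s hs p (by omega), hleft s' hs' p h1 (by omega)]
      refine W.digit_word_eq (by omega) (htn s' hs').le fun x hx hx' => ?_
      have h3 := hafter s hs x (by have := htn s' hs'; omega) (by omega)
      have h4 := hbefore s' hs' x hx'
      omega
    unfold position
    by_cases c1 : s' ≤ j
    · rw [if_pos (by omega), if_pos c1]
      exact hmiddle j c1 (by omega)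
    by_cases c2 : s ≤ j
    · rw [if_pos c2, if_neg c1, hleft s hs j c2 (by omega), hright s' hs' (j + k) (by omega)]
      have h1 := W.digit_word_eq (p := j) (Nat.zero_le (t s)) (htn s hs).le fun x _ hx => by
        have := hbefore s hs x hx
        omega
      have h2 := W.digit_word_eq (p := j + k) (t₀ := t s' + 1) (htn s' hs') le_rfl
        fun x hx hx' => by
          have := hafter s' hs' x hx' hx
          have := W.le_k hx'
          omega
      rw [← h1, h2, W.closed, W.start, W.finish]
      congr 1; omega
    · rw [if_neg c2, if_neg c1]
      exact hmiddle (j + k) (by omega) (by omega)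
  intro s hs s' hs' j hj hm hm'
  rcases lt_trichotomy s s' with h | rfl | h
  · exact key s hs s' hs' h j hj hm hm'
  · rfl
  · exact (key s' hs' s hs h j hj hm' hm).symm

/-- A short walk yields values of `k` coordinates such that any three of them are digits of a
common good number. -/
theorem exists_coordinates (W : LayerWalk k N good n lay word) (hn : n < 3 * k - 6) :
    ∃ x : ℕ → ℕ, ∀ a < k, ∀ b < k, ∀ c < k, a ≠ b → a ≠ c → b ≠ c →
      ∃ u, good u ∧ ∃ a' < k - 1, ∃ b' < k - 1, ∃ c' < k - 1, a' ≠ b' ∧ a' ≠ c' ∧ b' ≠ c' ∧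
        digit N u a' = x a ∧ digit N u b' = x b ∧ digit N u c' = x c := by
  classical
  have hk := W.k_ge
  have hS := W.four_le_card_singleLevels hn
  obtain ⟨e, hgood, he⟩ := W.exists_consistent_edges
  have hex : ∀ a < k, ∀ b < k, ∀ c < k, ∃ s ∈ singleLevels k lay n,
      ¬ Missing k s a ∧ ¬ Missing k s b ∧ ¬ Missing k s c := by
    intro a ha b hb c hc
    by_contra hcon
    push Not at hcon
    have hsub : singleLevels k lay n ⊆ ({a, b, c} : Finset ℕ).image
        fun j => if j + 1 = k then 0 else j + 1 := by
      intro s hs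
      have h1 := hcon s hs
      have hsk : s < k := Finset.mem_range.1 (Finset.mem_filter.1 hs).1
      have h2 : ∀ j, Missing k s j → s = if j + 1 = k then 0 else j + 1 := by
        intro j h
        unfold Missing at h
        split_ifs <;> omega
      simp only [Finset.mem_image, Finset.mem_insert, Finset.mem_singleton]
      by_cases ma : Missing k s a
      · exact ⟨a, by simp, (h2 a ma).symm⟩
      by_cases mb : Missing k s b
      · exact ⟨b, by simp, (h2 b mb).symm⟩
      · exact ⟨c, by simp, (h2 c (h1 ma mb)).symm⟩
    have h3 := (Finset.card_le_card hsub).trans Finset.card_image_le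
    have h4 := Finset.card_le_three (a := a) (b := b) (c := c)
    omega
  have hex1 : ∀ j < k, ∃ s ∈ singleLevels k lay n, ¬ Missing k s j := fun j hj => by
    obtain ⟨s, hs, h, -⟩ := hex j hj j hj j hj
    exact ⟨s, hs, h⟩
  choose! σ hσ hσm using hex1
  refine ⟨fun j => digit N (e (σ j)) (position k (σ j) j - σ j), ?_⟩
  intro a ha b hb c hc hab hac hbc
  obtain ⟨s, hs, ma, mb, mc⟩ := hex a ha b hb c hc
  have hsk : s < k := Finset.mem_range.1 (Finset.mem_filter.1 hs).1
  refine ⟨e s, hgood s hs, position k s a - s, ?_, position k s b - s, ?_, position k s c - s, ?_,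
    ?_, ?_, ?_, he s hs _ (hσ a ha) a ha ma (hσm a ha), he s hs _ (hσ b hb) b hb mb (hσm b hb),
    he s hs _ (hσ c hc) c hc mc (hσm c hc)⟩ <;>
  · unfold position
    unfold Missing at ma mb mc
    split_ifs <;> omega

end LayerWalk

/-! ### The layered graph of a hypergraph -/

theorem finRange_map_val (n : ℕ) : (List.finRange n).map Fin.val = List.range n := by
  simp

theorem flatMap_map_product_filter {α β γ δ : Type*} (l : List α) (r : List β) (P : α → Prop)
    [DecidablePred P] (f : α × β → γ) (g : γ → List δ) :
    (((l.filter fun a => P a) ×ˢ r).map f).flatMap g =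
      l.flatMap fun a => if P a then r.flatMap fun b => g (f (a, b)) else [] := by
  induction l with
  | nil => simp
  | cons a l ih =>
    rw [List.flatMap_cons, ← ih, List.filter_cons]
    by_cases h : P a
    · simp [h, List.product_cons, List.flatMap_map]
    · simp [h]

namespace UniformHypergraph

variable (H : UniformHypergraph 3)

theorem length_encode : H.encode.length = H.n ^ 3 + 1 := by simp [encode]

theorem encode_getD_zero : H.encode.getD 0 0 = H.n := by simp [encode]

theorem encode_getD_succ (a : ℕ) : H.encode.getD (1 + a) 0 =
    if h : a < H.n ^ 3 then
      if Finset.univ.image (finFunctionFinEquiv.symm (⟨a, h⟩ : Fin (H.n ^ 3))) ∈ H.edges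
        then 1 else 0
    else 0 := by
  rw [add_comm, encode, List.getD_cons_succ, List.getD_eq_getElem?_getD]
  by_cases h : a < H.n ^ 3
  · rw [List.getElem?_ofFn, dif_pos h, dif_pos h, Option.getD_some]
  · rw [List.getElem?_ofFn, dif_neg h, dif_neg h, Option.getD_none]

theorem encode_getD_succ_le (a : ℕ) : H.encode.getD (1 + a) 0 ≤ 1 := by
  rw [encode_getD_succ]; split_ifs <;> omega

theorem encode_getD_eq_one_iff (x y z : Fin H.n) :
    H.encode.getD (1 + (x + H.n * (y + H.n * z))) 0 = 1 ↔ {x, y, z} ∈ H.edges := by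
  have hval : (finFunctionFinEquiv ![x, y, z] : Fin (H.n ^ 3)).val =
      x + H.n * (y + H.n * z) := by
    rw [finFunctionFinEquiv_apply, Fin.sum_univ_three]
    simp
    ring
  have himage : Finset.univ.image ![x, y, z] = {x, y, z} := by
    ext v
    simp [Fin.exists_fin_succ, eq_comm]
  have hlt := (finFunctionFinEquiv ![x, y, z] : Fin (H.n ^ 3)).isLt
  rw [hval] at hlt
  have hsymm : finFunctionFinEquiv.symm (⟨_, hlt⟩ : Fin (H.n ^ 3)) = ![x, y, z] := by
    rw [Equiv.symm_apply_eq]; exact Fin.ext hval.symm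
  rw [encode_getD_succ, dif_pos hlt, hsymm, himage]
  simp

/-- The digit number `d` of `u` as a vertex. -/
def digitVertex (u d : ℕ) : Fin H.n := ⟨digit H.n u d, digit_lt H.n_pos u d⟩

theorem allTriples_iff (k u : ℕ) : AllTriples k H.n H.encode u ↔
    ∀ a < k - 1, ∀ b < k - 1, ∀ c < k - 1, a ≠ b → a ≠ c → b ≠ c →
      {H.digitVertex u a, H.digitVertex u b, H.digitVertex u c} ∈ H.edges := by
  have h : ∀ a b c, tensorEntry H.n H.encode u (a, b, c) = 1 ↔
      {H.digitVertex u a, H.digitVertex u b, H.digitVertex u c} ∈ H.edges := fun a b c =>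
    H.encode_getD_eq_one_iff (H.digitVertex u a) (H.digitVertex u b) (H.digitVertex u c)
  constructor
  · intro hu a ha b hb c hc hab hac hbc
    exact (h a b c).1 (hu _ (mem_digitTriples.2 ⟨⟨ha, hb, hc⟩, hab, hac, hbc⟩))
  · rintro hu ⟨a, b, c⟩ ht
    obtain ⟨⟨ha, hb, hc⟩, hab, hac, hbc⟩ := mem_digitTriples.1 ht
    exact (h a b c).2 (hu a ha b hb c hc hab hac hbc)

theorem hasClique_of_function {k : ℕ} (hk : 3 ≤ k) (x : ℕ → Fin H.n)
    (hx : ∀ a < k, ∀ b < k, ∀ c < k, a ≠ b → a ≠ c → b ≠ c → {x a, x b, x c} ∈ H.edges) :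
    H.HasClique k := by
  classical
  have hinj : Set.InjOn x (Finset.range k) := by
    intro a ha b hb hab
    by_contra hne
    rw [Finset.coe_range, Set.mem_Iio] at ha hb
    obtain ⟨c, hc, hac, hbc⟩ : ∃ c < k, a ≠ c ∧ b ≠ c := by
      by_cases h0 : a ≠ 0 ∧ b ≠ 0
      · exact ⟨0, by omega, h0.1, h0.2⟩
      by_cases h1 : a ≠ 1 ∧ b ≠ 1
      · exact ⟨1, by omega, h1.1, h1.2⟩
      · exact ⟨2, by omega, by omega, by omega⟩
    have h3 := H.uniform _ (hx a ha b hb c hc hne hac hbc)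
    rw [hab, Finset.insert_eq_of_mem (Finset.mem_insert_self _ _)] at h3
    have := Finset.card_le_two (a := x b) (b := x c)
    omega
  refine ⟨(Finset.range k).image x, by rw [Finset.card_image_of_injOn hinj, Finset.card_range],
    fun e he hcard => ?_⟩
  obtain ⟨p, q, r, hpq, hpr, hqr, rfl⟩ := Finset.card_eq_three.1 hcard
  have hmem : ∀ v ∈ ({p, q, r} : Finset (Fin H.n)), ∃ a < k, x a = v := fun v hv => by
    simpa using he hv
  obtain ⟨a, ha, rfl⟩ := hmem p (by simp)
  obtain ⟨b, hb, rfl⟩ := hmem q (by simp)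
  obtain ⟨c, hc, rfl⟩ := hmem r (by simp)
  exact hx a ha b hb c hc (fun h => hpq (by rw [h])) (fun h => hpr (by rw [h]))
    (fun h => hqr (by rw [h]))

theorem exists_function_of_hasClique {k : ℕ} (h : H.HasClique k) :
    ∃ x : ℕ → Fin H.n,
      ∀ a < k, ∀ b < k, ∀ c < k, a ≠ b → a ≠ c → b ≠ c → {x a, x b, x c} ∈ H.edges := by
  classical
  obtain ⟨S, hS, hclique⟩ := h
  let f := S.orderEmbOfFin hS
  have hfS : ∀ i, f i ∈ S := fun i => Finset.orderEmbOfFin_mem S hS i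
  refine ⟨fun a => if ha : a < k then f ⟨a, ha⟩ else ⟨0, H.n_pos⟩, ?_⟩
  intro a ha b hb c hc hab hac hbc
  simp only [dif_pos ha, dif_pos hb, dif_pos hc]
  have hne : ∀ {i j : ℕ} (hi : i < k) (hj : j < k), i ≠ j → f ⟨i, hi⟩ ≠ f ⟨j, hj⟩ :=
    fun hi hj hij h => hij (congrArg Fin.val (f.injective h))
  refine hclique _ ?_ (Finset.card_eq_three.2 ⟨_, _, _, hne ha hb hab, hne ha hc hac,
    hne hb hc hbc, rfl⟩)
  intro v hv
  simp only [Finset.mem_insert, Finset.mem_singleton] at hv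
  rcases hv with rfl | rfl | rfl <;> exact hfS _

end UniformHypergraph

/-- The vertex `y` of the layer `i`. -/
def layerVertex {k M : ℕ} (i y : ℕ) (hi : i < k + 1) (hy : y < M) : Fin ((k + 1) * M) :=
  ⟨i * M + y, by
    have h := Nat.mul_le_mul_right M (Nat.le_of_lt_succ hi)
    have h' : (k + 1) * M = k * M + M := Nat.succ_mul _ _
    omega⟩

theorem layerVertex_div {k M i y : ℕ} (hi : i < k + 1) (hy : y < M) :
    (layerVertex i y hi hy : ℕ) / M = i := by
  change (i * M + y) / M = i
  rw [mul_comm, Nat.mul_add_div (by omega), Nat.div_eq_of_lt hy, add_zero]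

theorem layerVertex_mod {k M i y : ℕ} (hi : i < k + 1) (hy : y < M) :
    (layerVertex i y hi hy : ℕ) % M = y := by
  change (i * M + y) % M = y
  rw [mul_comm, Nat.mul_add_mod, Nat.mod_eq_of_lt hy]

namespace UniformHypergraph

variable (H : UniformHypergraph 3) (k : ℕ)

/-- The size of a layer. -/
def layerSize : ℕ := H.n ^ (k - 2)

theorem layerSize_pos : 0 < H.layerSize k := pow_pos H.n_pos _

theorem mod_lt_layerSize (u : ℕ) : u % H.layerSize k < H.layerSize k :=
  Nat.mod_lt _ (H.layerSize_pos k)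

theorem div_lt_layerSize {u : ℕ} (hu : u < H.layerSize k * H.n) : u / H.n < H.layerSize k := by
  rwa [Nat.div_lt_iff_lt_mul H.n_pos]

/-- The edge of the layered graph between the layers `i` and `i + 1` that belongs to `u`. -/
def layeredEdge (q : Fin (H.layerSize k * H.n) × Fin k) :
    Fin ((k + 1) * H.layerSize k) × Fin ((k + 1) * H.layerSize k) :=
  (layerVertex q.2 (q.1 % H.layerSize k) (by omega) (H.mod_lt_layerSize k _),
    layerVertex (q.2 + 1) (q.1 / H.n) (by omega) (H.div_lt_layerSize k q.1.isLt))

/-- The edges of the layered graph. -/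
def layeredEdgeList :
    List (Fin ((k + 1) * H.layerSize k) × Fin ((k + 1) * H.layerSize k)) :=
  (((List.finRange (H.layerSize k * H.n)).reverse.filter
    fun u : Fin _ => AllTriples k H.n H.encode u) ×ˢ List.finRange k).map (H.layeredEdge k)

/-- The pairs of the two copies of a word in the first and in the last layer. -/
def layeredPairs : List (Fin ((k + 1) * H.layerSize k) × Fin ((k + 1) * H.layerSize k)) :=
  (List.finRange (H.layerSize k)).reverse.map fun y : Fin (H.layerSize k) =>
    (layerVertex 0 y (by omega) y.isLt, layerVertex k y (by omega) y.isLt)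

theorem layeredEdge_sym2_injective (hk : 3 ≤ k) :
    Function.Injective fun q => s((H.layeredEdge k q).1, (H.layeredEdge k q).2) := by
  rintro ⟨u, i⟩ ⟨v, j⟩ h
  have hM := H.layerSize_pos k
  have hdvd : H.n ∣ H.layerSize k := dvd_pow_self _ (by omega)
  rcases Sym2.eq_iff.1 h with ⟨h1, h2⟩ | ⟨h1, h2⟩
  · have d1 := congrArg (fun v : Fin _ => (v : ℕ) / H.layerSize k) h1
    have m1 := congrArg (fun v : Fin _ => (v : ℕ) % H.layerSize k) h1
    have m2 := congrArg (fun v : Fin _ => (v : ℕ) % H.layerSize k) h2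
    simp only [layeredEdge, layerVertex_div, layerVertex_mod] at d1 m1 m2
    have m3 := congrArg (· % H.n) m1
    simp only [Nat.mod_mod_of_dvd _ hdvd] at m3
    have huv : (u : ℕ) = v := by rw [← Nat.div_add_mod u H.n, m2, m3, Nat.div_add_mod]
    exact Prod.ext (Fin.ext huv) (Fin.ext d1)
  · have d1 := congrArg (fun v : Fin _ => (v : ℕ) / H.layerSize k) h1
    have d2 := congrArg (fun v : Fin _ => (v : ℕ) / H.layerSize k) h2
    simp only [layeredEdge, layerVertex_div] at d1 d2
    omega

/-- The layered graph. -/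
def layeredGraph : SimpleGraph (Fin ((k + 1) * H.layerSize k)) :=
  SimpleGraph.fromEdgeSet {e | e ∈ (H.layeredEdgeList k).map fun e => s(e.1, e.2)}

theorem mem_layeredEdgeList (e : Sym2 (Fin ((k + 1) * H.layerSize k))) :
    e ∈ (H.layeredEdgeList k).map (fun e => s(e.1, e.2)) ↔ e ∈ (H.layeredGraph k).edgeSet := by
  rw [layeredGraph, SimpleGraph.edgeSet_fromEdgeSet, Set.mem_sdiff, Set.mem_ofPred_eq,
    iff_self_and]
  intro he hdiag
  rw [layeredEdgeList, List.map_map] at he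
  obtain ⟨⟨u, i⟩, -, rfl⟩ := List.mem_map.1 he
  have h := congrArg (fun v : Fin _ => (v : ℕ) / H.layerSize k) (Sym2.mk_isDiag_iff.1 hdiag)
  simp only [layeredEdge, layerVertex_div] at h
  omega

/-- The instance of `n`-pairs minimum distance in which one looks for a hyperclique. -/
def layeredInstance (hk : 3 ≤ k) : PairsInstance where
  n := (k + 1) * H.layerSize k
  n_pos := Nat.mul_pos (by omega) (H.layerSize_pos k)
  graph := H.layeredGraph k
  edgeList := H.layeredEdgeList k
  edgeList_nodup := by
    rw [layeredEdgeList, List.map_map]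
    refine List.Nodup.map (H.layeredEdge_sym2_injective k hk) (List.Nodup.product ?_ ?_)
    · exact (List.nodup_reverse.2 (List.nodup_finRange _)).filter _
    · exact List.nodup_finRange _
  mem_edgeList := H.mem_layeredEdgeList k
  pairs := H.layeredPairs k
  pairs_ne_nil := by
    have h : (H.layeredPairs k).length = H.layerSize k := by simp [layeredPairs]
    have := H.layerSize_pos k
    exact List.ne_nil_of_length_pos (by omega)
  length_pairs_le := by
    have h : (H.layeredPairs k).length = H.layerSize k := by simp [layeredPairs]
    rw [h]
    exact Nat.le_mul_of_pos_left _ (by omega)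

theorem layeredEdgeList_flatMap :
    (H.layeredEdgeList k).flatMap (fun q => [(q.1 : ℕ), (q.2 : ℕ)]) =
      allEdgeWords k H.n (H.layerSize k) (H.layerSize k * H.n) H.encode := by
  rw [layeredEdgeList, flatMap_map_product_filter (P := fun u : Fin _ =>
    AllTriples k H.n H.encode u), allEdgeWords, ← finRange_map_val, ← List.map_reverse,
    List.flatMap_map]
  refine congrArg (fun f => List.flatMap f _) (funext fun u => ?_)
  rw [edgeWords, ← finRange_map_val, List.flatMap_map]
  rfl

theorem layeredPairs_flatMap :
    (H.layeredPairs k).flatMap (fun q => [(q.1 : ℕ), (q.2 : ℕ)]) =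
      allPairWords k (H.layerSize k) := by
  rw [layeredPairs, List.flatMap_map, allPairWords, ← finRange_map_val, ← List.map_reverse,
    List.flatMap_map]
  refine congrArg (fun f => List.flatMap f _) (funext fun y => ?_)
  simp [layerVertex, pairWords]

theorem encode_layeredInstance (hk : 3 ≤ k) : (H.layeredInstance k hk).encode =
    layeredWords k H.n (H.layerSize k) (H.layerSize k * H.n) H.encode := by
  have hpairs : (H.layeredPairs k).length = H.layerSize k := by simp [layeredPairs]
  have hlen : (H.layeredEdgeList k).length =
      (allEdgeWords k H.n (H.layerSize k) (H.layerSize k * H.n) H.encode).length / 2 := by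
    rw [← layeredEdgeList_flatMap]
    simp [List.length_flatMap]
  unfold PairsInstance.encode PairsInstance.m layeredInstance layeredWords
  dsimp only
  rw [List.flatMap_append, layeredEdgeList_flatMap, layeredPairs_flatMap, hlen, hpairs,
    List.append_assoc]

theorem layeredInstance_m_le (hk : 3 ≤ k) :
    (H.layeredInstance k hk).m ≤ k * (H.layerSize k * H.n) := by
  change (H.layeredEdgeList k).length ≤ _
  rw [layeredEdgeList, List.length_map, List.length_product, List.length_finRange, mul_comm]
  refine Nat.mul_le_mul_left _ ((List.length_filter_le _ _).trans ?_)
  simp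

theorem layeredGraph_adj (a b : Fin ((k + 1) * H.layerSize k)) :
    (H.layeredGraph k).Adj a b ↔ ∃ u < H.layerSize k * H.n, ∃ i < k,
      AllTriples k H.n H.encode u ∧
      (((a : ℕ) = i * H.layerSize k + u % H.layerSize k ∧
        (b : ℕ) = (i + 1) * H.layerSize k + u / H.n) ∨
       ((b : ℕ) = i * H.layerSize k + u % H.layerSize k ∧
        (a : ℕ) = (i + 1) * H.layerSize k + u / H.n)) := by
  rw [← SimpleGraph.mem_edgeSet, ← mem_layeredEdgeList, layeredEdgeList, List.map_map]
  have hmem : ∀ (u : Fin (H.layerSize k * H.n)) (i : Fin k),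
      (u, i) ∈ ((List.finRange (H.layerSize k * H.n)).reverse.filter
        fun u : Fin _ => AllTriples k H.n H.encode u) ×ˢ List.finRange k ↔
        AllTriples k H.n H.encode u := by simp
  simp only [List.mem_map, Function.comp, Prod.exists, hmem]
  constructor
  · rintro ⟨u, i, hu, h⟩
    refine ⟨u, u.isLt, i, i.isLt, hu, ?_⟩
    rcases Sym2.eq_iff.1 h with ⟨rfl, rfl⟩ | ⟨rfl, rfl⟩
    · exact Or.inl ⟨rfl, rfl⟩
    · exact Or.inr ⟨rfl, rfl⟩
  · rintro ⟨u, hu, i, hi, hgood, h⟩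
    refine ⟨⟨u, hu⟩, ⟨i, hi⟩, hgood, Sym2.eq_iff.2 ?_⟩
    rcases h with ⟨h1, h2⟩ | ⟨h1, h2⟩
    · exact Or.inl ⟨Fin.ext h1.symm, Fin.ext h2.symm⟩
    · exact Or.inr ⟨Fin.ext h1.symm, Fin.ext h2.symm⟩

end UniformHypergraph

namespace UniformHypergraph

variable (H : UniformHypergraph 3) {k : ℕ}

theorem layerVertex_edist_le (hk : 4 ≤ k) {x : ℕ → Fin H.n}
    (hx : ∀ a < k, ∀ b < k, ∀ c < k, a ≠ b → a ≠ c → b ≠ c → {x a, x b, x c} ∈ H.edges) :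
    ∃ y : ℕ → ℕ, y k = y 0 ∧ ∃ hy : ∀ i, y i < H.layerSize k, ∀ i, ∀ hi : i ≤ k,
      (H.layeredGraph k).edist (layerVertex 0 (y 0) (by omega) (hy 0))
        (layerVertex i (y i) (by omega) (hy i)) ≤ i := by
  set f : ℕ → ℕ → ℕ := fun i d => x ((i + d) % k) with hf
  have hfN : ∀ i d, f i d < H.n := fun i d => (x _).isLt
  set y : ℕ → ℕ := fun i => ofDigitFun H.n (k - 2) (f i) with hy
  have hyM : ∀ i, y i < H.layerSize k := fun i => ofDigitFun_lt (hfN i)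
  refine ⟨y, ?_, hyM, fun i => ?_⟩
  · have h : f k = f 0 := by ext d; simp [hf]
    simp only [hy, h]
  induction i with
  | zero => exact fun _ => by simp
  | succ i ih =>
    intro hi
    set u := ofDigitFun H.n (k - 1) (f i) with hu
    have hk1 : k - 1 = (k - 2) + 1 := by omega
    have huU : u < H.layerSize k * H.n := by
      have h : u < H.n ^ (k - 1) := ofDigitFun_lt (hfN i)
      rwa [hk1, pow_succ] at h
    have hmod : u % H.layerSize k = y i := by
      rw [hu, hk1]; exact ofDigitFun_succ_mod _ (hfN i)
    have hdiv : u / H.n = y (i + 1) := by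
      rw [hu, hk1, ofDigitFun_succ_div _ (hfN i), hy]
      have h : (fun d => f i (d + 1)) = f (i + 1) := by
        ext d; simp only [hf]; rw [add_right_comm, add_assoc]
      rw [h]
    have hdigit : ∀ a < k - 1, H.digitVertex u a = x ((i + a) % k) := fun a ha =>
      Fin.ext (digit_ofDigitFun (hfN i) ha)
    have hgood : AllTriples k H.n H.encode u := by
      rw [allTriples_iff]
      intro a ha b hb c hc hab hac hbc
      rw [hdigit a ha, hdigit b hb, hdigit c hc]
      have hne : ∀ a b, a < k - 1 → b < k - 1 → a ≠ b → (i + a) % k ≠ (i + b) % k := by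
        intro a b ha hb hab h
        have h1 : a % k = b % k := Nat.ModEq.add_left_cancel' i h
        rw [Nat.mod_eq_of_lt (by omega), Nat.mod_eq_of_lt (by omega)] at h1
        exact hab h1
      exact hx _ (Nat.mod_lt _ (by omega)) _ (Nat.mod_lt _ (by omega)) _
        (Nat.mod_lt _ (by omega)) (hne a b ha hb hab) (hne a c ha hc hac) (hne b c hb hc hbc)
    have hadj : (H.layeredGraph k).Adj (layerVertex i (y i) (by omega) (hyM i))
        (layerVertex (i + 1) (y (i + 1)) (by omega) (hyM (i + 1))) := by
      rw [layeredGraph_adj]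
      exact ⟨u, huU, i, by omega, hgood, Or.inl ⟨by rw [hmod]; rfl, by rw [hdiv]; rfl⟩⟩
    refine (SimpleGraph.edist_triangle (v := layerVertex i (y i) (by omega) (hyM i))).trans ?_
    rw [SimpleGraph.edist_eq_one_iff_adj.2 hadj]
    push_cast
    exact add_le_add_left (ih (by omega)) 1

theorem minDist_layeredInstance_le (hk : 4 ≤ k) (h : H.HasClique k) :
    (H.layeredInstance k (by omega)).minDist ≤ k := by
  obtain ⟨x, hx⟩ := H.exists_function_of_hasClique h
  obtain ⟨y, hyk, hy, hdist⟩ := H.layerVertex_edist_le hk hx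
  have hmem : (layerVertex 0 (y 0) (by omega) (hy 0), layerVertex k (y k) (by omega) (hy k)) ∈
      H.layeredPairs k := by
    simp only [layeredPairs, List.mem_map, List.mem_reverse, List.mem_finRange, true_and]
    refine ⟨⟨y 0, hy 0⟩, ?_⟩
    simp only [hyk]
  exact (iInf₂_le (f := fun q (_ : q ∈ H.layeredPairs k) => (H.layeredGraph k).edist q.1 q.2)
    _ hmem).trans (hdist k le_rfl)

theorem layerStep_of_adj {a b : Fin ((k + 1) * H.layerSize k)}
    (h : (H.layeredGraph k).Adj a b) :
    LayerStep k H.n (fun u => AllTriples k H.n H.encode u) (a / H.layerSize k)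
      (a % H.layerSize k) (b / H.layerSize k) (b % H.layerSize k) := by
  obtain ⟨u, hu, i, hi, hgood, h⟩ := (H.layeredGraph_adj k a b).1 h
  have h1 := H.mod_lt_layerSize k u
  have h2 := H.div_lt_layerSize k hu
  have d1 : (i * H.layerSize k + u % H.layerSize k) / H.layerSize k = i :=
    layerVertex_div (k := k) (by omega) h1
  have m1 : (i * H.layerSize k + u % H.layerSize k) % H.layerSize k = u % H.layerSize k :=
    layerVertex_mod (k := k) (i := i) (by omega) h1
  have d2 : ((i + 1) * H.layerSize k + u / H.n) / H.layerSize k = i + 1 :=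
    layerVertex_div (k := k) (by omega) h2
  have m2 : ((i + 1) * H.layerSize k + u / H.n) % H.layerSize k = u / H.n :=
    layerVertex_mod (k := k) (i := i + 1) (by omega) h2
  refine ⟨u, hgood, ?_⟩
  rcases h with ⟨h3, h4⟩ | ⟨h3, h4⟩
  · left; rw [h3, h4, d1, m1, d2, m2]; exact ⟨hi, rfl, rfl, rfl⟩
  · right; rw [h3, h4, d1, m1, d2, m2]; exact ⟨hi, rfl, rfl, rfl⟩

theorem hasClique_of_layerWalk {n : ℕ} {lay word : ℕ → ℕ}
    (W : LayerWalk k H.n (fun u => AllTriples k H.n H.encode u) n lay word)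
    (hn : n < 3 * k - 6) : H.HasClique k := by
  have hk := W.k_ge
  obtain ⟨x, hx⟩ := W.exists_coordinates hn
  refine H.hasClique_of_function (by omega) (fun a => ⟨x a % H.n, Nat.mod_lt _ H.n_pos⟩) ?_
  intro a ha b hb c hc hab hac hbc
  obtain ⟨u, hu, a', ha', b', hb', c', hc', hab', hac', hbc', h1, h2, h3⟩ :=
    hx a ha b hb c hc hab hac hbc
  have h := (H.allTriples_iff k u).1 hu a' ha' b' hb' c' hc' hab' hac' hbc'
  have hv : ∀ d z, digit H.n u d = z →
      H.digitVertex u d = ⟨z % H.n, Nat.mod_lt _ H.n_pos⟩ := by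
    rintro d z rfl
    exact Fin.ext (Nat.mod_eq_of_lt (digit_lt H.n_pos u d)).symm
  rwa [hv a' _ h1, hv b' _ h2, hv c' _ h3] at h

theorem le_minDist_layeredInstance (hk : 4 ≤ k) (h : ¬ H.HasClique k) :
    ((3 * k - 6 : ℕ) : ℕ∞) ≤ (H.layeredInstance k (by omega)).minDist := by
  suffices key : ∀ q ∈ H.layeredPairs k,
      ((3 * k - 6 : ℕ) : ℕ∞) ≤ (H.layeredGraph k).edist q.1 q.2 from le_iInf₂ key
  intro q hq
  obtain ⟨y, -, rfl⟩ := List.mem_map.1 hq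
  by_contra! hlt
  obtain ⟨p, hp⟩ := SimpleGraph.exists_walk_of_edist_ne_top (hlt.trans_le le_top).ne
  rw [← hp] at hlt
  refine h (H.hasClique_of_layerWalk (n := p.length)
    (lay := fun t => (p.getVert t : ℕ) / H.layerSize k)
    (word := fun t => (p.getVert t : ℕ) % H.layerSize k) ?_ (by exact_mod_cast hlt))
  refine ⟨hk, ?_, ?_, ?_, fun t ht => H.layerStep_of_adj (p.adj_getVert_succ ht)⟩
  · simp only [SimpleGraph.Walk.getVert_zero, layerVertex_div]
  · simp only [SimpleGraph.Walk.getVert_length, layerVertex_div]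
  · simp only [SimpleGraph.Walk.getVert_zero, SimpleGraph.Walk.getVert_length, layerVertex_mod]

end UniformHypergraph

/-! ### The reduction -/

/-- Decide from the estimate of the minimum distance whether there is a hyperclique. -/
def answerProgram (k : ℕ) : Program :=
  .block [.const 2 (3 * k - 6), .op .less 3 1 2, .const 4 0, .ite 0 (.block [.op .plus 0 3 4]) .skip]

theorem answerProgram_halts {w k : ℕ} (h : 3 * k < 2 ^ w) (hw : 1 < 2 ^ w) (s : State) :
    (answerProgram k).Halts w 7
      (fun s' => s'.reg 0 = if s.reg 0 ≠ 0 ∧ s.reg 1 < 3 * k - 6 then 1 else 0) s := by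
  refine Program.Halts.mono (T := (2 + 1 + 1) + 1 + 1 + 1) ?_ le_rfl (fun _ h => h)
  refine halts_const 2 (3 * k - 6) (by omega) ?_
  refine halts_op .less 3 1 2 (if s.reg 1 < 3 * k - 6 then 1 else 0) (by simp [WordOp.eval])
    (by split_ifs <;> omega) ?_
  refine halts_const 4 0 (by omega) ?_
  refine halts_block_cons (T := 2 + 1) (T' := 1) (halts_ite 0 (fun h0 => ?_) (fun h0 => ?_))
  · simp only [State.put_reg] at h0
    refine halts_plus 0 3 4 (if s.reg 1 < 3 * k - 6 then 1 else 0) (by simp)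
      (by split_ifs <;> omega) (halts_block_nil (halts_block_nil ?_))
    simp only [State.put_reg]
    simp at h0
    simp [h0]
  · simp at h0
    refine halts_skip (halts_block_nil ?_)
    simp [h0]

/-- The program for hyperclique detection that uses a program `p` for `n`-pairs minimum distance. -/
def reductionProgram (k : ℕ) (p : Program) : Program :=
  .seq (buildProgram k) (.seq p (answerProgram k))

theorem PairsInstance.lt_of_mem_encode (I : PairsInstance) {W : ℕ} (hn : I.n < W) (hm : I.m < W)
    {v : ℕ} (hv : v ∈ I.encode) : v < W := by
  have hp := I.length_pairs_le
  simp only [encode, List.mem_append, List.mem_flatMap, List.mem_cons, List.not_mem_nil,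
    or_false] at hv
  rcases hv with (rfl | rfl | rfl) | ⟨q, -, rfl | rfl⟩
  · exact hn
  · exact hm
  · omega
  · exact q.1.isLt.trans hn
  · exact q.2.isLt.trans hn

theorem getD_lt_of_forall_mem {l : List ℕ} {W : ℕ} (hW : 0 < W) (h : ∀ v ∈ l, v < W) (a : ℕ) :
    l.getD a 0 < W := by
  rcases lt_or_ge a l.length with ha | ha
  · rw [List.getD_eq_getElem _ _ ha]; exact h _ (List.getElem_mem ha)
  · rwa [List.getD_eq_default _ _ ha]

theorem exists_layout {k N w : ℕ} (hk : 4 ≤ k) (hN : 0 < N)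
    (hw : (3 * k + 7) * (Nat.log 2 N + 1) ≤ w) :
    Layout w k N (N ^ (k - 2)) (N ^ (k - 2) * N) ((2 * k + 5) * (N ^ (k - 2) * N)) := by
  have hU : N ^ (k - 2) * N = N ^ (k - 1) := by
    rw [← pow_succ]; congr 1; omega
  have h3 : N ^ 3 ≤ N ^ (k - 2) * N := by
    rw [hU]; exact Nat.pow_le_pow_right hN (by omega)
  refine ⟨hk, hN, rfl, rfl, rfl, h3, ?_⟩
  have hpos : 0 < N ^ (k - 2) * N := by positivity
  have hlog : N < 2 ^ (Nat.log 2 N + 1) := Nat.lt_pow_succ_log_self (by norm_num) N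
  calc (2 * k + 5) * (N ^ (k - 2) * N) + N ^ 3 + 1
      ≤ (2 * k + 7) * (N ^ (k - 2) * N) := by nlinarith
    _ = (2 * k + 7) * N ^ (k - 1) := by rw [hU]
    _ < 2 ^ (2 * k + 7) * (2 ^ (Nat.log 2 N + 1)) ^ (k - 1) :=
        Nat.mul_lt_mul_of_lt_of_le Nat.lt_two_pow_self (Nat.pow_le_pow_left hlog.le _)
          (by positivity)
    _ = 2 ^ (2 * k + 7 + (Nat.log 2 N + 1) * (k - 1)) := by rw [← pow_mul, ← pow_add]
    _ ≤ 2 ^ w := by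
        refine Nat.pow_le_pow_right (by norm_num) (le_trans ?_ hw)
        have : (Nat.log 2 N + 1) * (k - 1) ≤ k * (Nat.log 2 N + 1) := by
          rw [mul_comm]; exact Nat.mul_le_mul_right _ (by omega)
        nlinarith

theorem log_layeredInstance_le {k N : ℕ} (hk : 4 ≤ k) (hN : 0 < N) :
    Nat.log 2 ((k + 1) * N ^ (k - 2)) + 1 ≤ 2 * k * (Nat.log 2 N + 1) := by
  have hlog : N < 2 ^ (Nat.log 2 N + 1) := Nat.lt_pow_succ_log_self (by norm_num) N
  refine Nat.log_lt_of_lt_pow (by positivity) ?_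
  calc (k + 1) * N ^ (k - 2)
      < 2 ^ (k + 1) * (2 ^ (Nat.log 2 N + 1)) ^ (k - 2) :=
        Nat.mul_lt_mul_of_lt_of_le Nat.lt_two_pow_self (Nat.pow_le_pow_left hlog.le _)
          (by positivity)
    _ = 2 ^ (k + 1 + (Nat.log 2 N + 1) * (k - 2)) := by rw [← pow_mul, ← pow_add]
    _ ≤ 2 ^ (2 * k * (Nat.log 2 N + 1)) := by
        refine Nat.pow_le_pow_right (by norm_num) ?_
        obtain ⟨j, rfl⟩ : ∃ j, k = j + 2 := ⟨k - 2, by omega⟩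
        rw [Nat.add_sub_cancel]
        nlinarith

/-- The program `answerProgram` turns a correct estimate for the layered graph into a correct answer
for the hypergraph. -/
theorem correct_answer {k : ℕ} (hk : 4 ≤ k) {α : ℝ} (hα : α < 3 - 6 / (k : ℝ))
    (H : UniformHypergraph 3) {out out' : ℕ → ℕ}
    (h : (pairsMinDistApprox α).Correct (H.layeredInstance k (by omega)) out)
    (h' : out' 0 = if out 0 ≠ 0 ∧ out 1 < 3 * k - 6 then 1 else 0) :
    (hypercliqueDetection k 3).Correct H out' := by
  obtain ⟨h1, h2⟩ := h
  by_cases hc : H.HasClique k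
  · refine Or.inl ⟨hc, h'.trans (if_pos ?_)⟩
    have h3 := H.minDist_layeredInstance_le hk hc
    have h4 : (((H.layeredInstance k (by omega)).minDist : ℕ∞) : ℝ≥0∞) ≤ ENNReal.ofReal k := by
      rw [ENNReal.ofReal_natCast]
      exact_mod_cast h3
    have h5 : ENNReal.ofReal α * ENNReal.ofReal k < ((3 * k - 6 : ℕ) : ℝ≥0∞) := by
      have hk0 : (0 : ℝ) < k := by exact_mod_cast (by omega : 0 < k)
      have hk4 : (4 : ℝ) ≤ k := by exact_mod_cast hk
      rw [← ENNReal.ofReal_mul' hk0.le, ← ENNReal.ofReal_natCast (3 * k - 6)]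
      have h6 : ((3 * k - 6 : ℕ) : ℝ) = 3 * k - 6 := by
        rw [Nat.cast_sub (by omega)]; push_cast; ring
      rw [h6]
      refine (ENNReal.ofReal_lt_ofReal_iff (by linarith)).2 ?_
      calc α * k < (3 - 6 / k) * k := by gcongr
        _ = 3 * k - 6 := by field_simp
    have h6 : ((outputEstimate out : ℕ∞) : ℝ≥0∞) < ((3 * k - 6 : ℕ) : ℝ≥0∞) :=
      (h2.trans (by gcongr)).trans_lt h5
    have h7 : outputEstimate out < ((3 * k - 6 : ℕ) : ℕ∞) := by exact_mod_cast h6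
    unfold outputEstimate at h7
    split_ifs at h7 with h0
    · simp at h7
    · exact ⟨h0, by exact_mod_cast h7⟩
  · refine Or.inr ⟨hc, h'.trans (if_neg ?_)⟩
    rintro ⟨h0, h3⟩
    have h4 := (H.le_minDist_layeredInstance hk hc).trans h1
    rw [outputEstimate, if_neg h0] at h4
    have h5 : 3 * k - 6 ≤ out 1 := by exact_mod_cast h4
    omega

/-- A run of a program on the layered graph yields a run of the reduction on the hypergraph. -/
theorem reductionProgram_exec {k : ℕ} (hk : 4 ≤ k) {α : ℝ} (hα : α < 3 - 6 / (k : ℝ))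
    (H : UniformHypergraph 3) {w : ℕ} (hw : (3 * k + 7) * (Nat.log 2 H.n + 1) ≤ w)
    {p : Program} {ω : ℕ → Bool} {s : State} {t : ℕ}
    (h : Exec w p (State.init w (H.layeredInstance k (by omega)).encode ω) s t) :
    ∃ s' t', Exec w (reductionProgram k p) (State.init w H.encode ω) s' t' ∧
      t' ≤ (edgeTime k + 2 * k + 200) * H.n ^ (k - 1) + t + 7 ∧
      ((pairsMinDistApprox α).Correct (H.layeredInstance k (by omega)) s.reg →
        (hypercliqueDetection k 3).Correct H s'.reg) := by
  have hl := exists_layout hk H.n_pos hw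
  have hU : H.n ^ (k - 2) * H.n = H.n ^ (k - 1) := by
    rw [← pow_succ]; congr 1; omega
  have hlt := hl.lt_word
  have hkB := hl.k_le
  obtain ⟨s₁, t₁, e₁, ht₁, hs₁⟩ := buildProgram_halts hl H.length_encode H.encode_getD_zero
    H.encode_getD_succ_le ω
  have hinit : s₁ = State.init w (H.layeredInstance k (by omega)).encode ω := by
    have hn : (H.layeredInstance k (by omega)).n < 2 ^ w := by
      have h1 : (k + 1) * H.n ^ (k - 2) ≤ _ := hl.mul_le (by omega) hl.M_le
      change (k + 1) * H.n ^ (k - 2) < 2 ^ w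
      omega
    have hm : (H.layeredInstance k (by omega)).m < 2 ^ w := by
      have h1 : k * (H.n ^ (k - 2) * H.n) ≤ _ := hl.mul_le (by omega) le_rfl
      have h2 : _ ≤ k * (H.n ^ (k - 2) * H.n) := H.layeredInstance_m_le k (by omega)
      omega
    rw [hs₁, State.init, State.mk.injEq]
    refine ⟨rfl, funext fun a => ?_, rfl⟩
    rw [Nat.mod_eq_of_lt (getD_lt_of_forall_mem (by positivity)
      (fun v hv => PairsInstance.lt_of_mem_encode _ hn hm hv) a), H.encode_layeredInstance k]
    rfl
  rw [hinit] at e₁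
  have h3k : 3 * k < 2 ^ w := by
    have h1 : (3 * k + 7) * 1 ≤ (3 * k + 7) * (Nat.log 2 H.n + 1) :=
      Nat.mul_le_mul_left _ (by omega)
    have h2 : w < 2 ^ w := Nat.lt_two_pow_self
    omega
  obtain ⟨s₃, t₃, e₃, ht₃, hs₃⟩ := answerProgram_halts h3k (by omega) s
  refine ⟨s₃, _, .seq e₁ (.seq h e₃), ?_, fun hc => correct_answer hk hα H hc hs₃⟩
  rw [hU] at ht₁
  omega

theorem reductionProgram_deterministic {k : ℕ} {p : Program} (hp : p.Deterministic) :
    (reductionProgram k p).Deterministic :=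
  ⟨buildProgram_deterministic k, hp, trivial, trivial, trivial, ⟨⟨trivial, trivial⟩, trivial⟩,
    trivial⟩

/-- A sufficiently fast algorithm for `n`-pairs minimum distance refutes the hypothesis. -/
theorem not_solvableInTime_of_hypercliqueHypothesis {kind : AlgKind} {k : ℕ} (hk : 4 ≤ k)
    (hyp : HypercliqueHypothesis kind k 3) {α : ℝ} (hα : α < 3 - 6 / (k : ℝ))
    (T : PairsInstance → ℝ) {δ K : ℝ} (hδ : 0 < δ) (hδ1 : δ ≤ 1) (hT0 : ∀ I, 0 ≤ T I)
    (hT : ∀ H : UniformHypergraph 3,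
      T (H.layeredInstance k (by omega)) ≤ K * (H.n : ℝ) ^ ((k : ℝ) - δ)) :
    ¬ (pairsMinDistApprox α).SolvableInTime kind T := by
  rintro ⟨p, c, C, hp⟩
  refine hyp δ hδ ⟨reductionProgram k p, 2 * k * c + (3 * k + 7),
    ((edgeTime k + 2 * k + 200 : ℕ) : ℝ) + |C| * K + 7, fun H w hw => ?_⟩
  change (2 * k * c + (3 * k + 7)) * (Nat.log 2 H.n + 1) ≤ w at hw
  have hw1 : (3 * k + 7) * (Nat.log 2 H.n + 1) ≤ w :=
    (Nat.mul_le_mul_right _ (by omega)).trans hw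
  have hw2 : c * (Nat.log 2 ((k + 1) * H.n ^ (k - 2)) + 1) ≤ w := by
    calc c * (Nat.log 2 ((k + 1) * H.n ^ (k - 2)) + 1)
        ≤ c * (2 * k * (Nat.log 2 H.n + 1)) :=
          Nat.mul_le_mul_left _ (log_layeredInstance_le hk H.n_pos)
      _ = 2 * k * c * (Nat.log 2 H.n + 1) := by ring
      _ ≤ w := (Nat.mul_le_mul_right _ (by omega)).trans hw
  have hpI := hp (H.layeredInstance k (by omega)) w hw2
  have hn1 : (1 : ℝ) ≤ H.n := by exact_mod_cast H.n_pos
  have hk4 : (4 : ℝ) ≤ k := by exact_mod_cast hk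
  have htime : ∀ t t' : ℕ, (t : ℝ) ≤ C * T (H.layeredInstance k (by omega)) →
      t' ≤ (edgeTime k + 2 * k + 200) * H.n ^ (k - 1) + t + 7 →
      (t' : ℝ) ≤ (((edgeTime k + 2 * k + 200 : ℕ) : ℝ) + |C| * K + 7) *
        (H.n : ℝ) ^ ((k : ℝ) - δ) := by
    intro t t' ht ht'
    set X := (H.n : ℝ) ^ ((k : ℝ) - δ) with hX
    have h1 : (t' : ℝ) ≤ ((edgeTime k + 2 * k + 200 : ℕ) : ℝ) * (H.n : ℝ) ^ (k - 1) + t + 7 := by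
      exact_mod_cast ht'
    have h2 : (H.n : ℝ) ^ (k - 1) ≤ X := by
      rw [← Real.rpow_natCast, hX, Nat.cast_sub (by omega)]
      exact Real.rpow_le_rpow_of_exponent_le hn1 (by push_cast; linarith)
    have h3 : (1 : ℝ) ≤ X := Real.one_le_rpow hn1 (by linarith)
    have h4 : (t : ℝ) ≤ |C| * (K * X) := by
      refine ht.trans ((mul_le_mul_of_nonneg_right (le_abs_self C) (hT0 _)).trans ?_)
      exact mul_le_mul_of_nonneg_left (hT H) (abs_nonneg C)
    have h5 : ((edgeTime k + 2 * k + 200 : ℕ) : ℝ) * (H.n : ℝ) ^ (k - 1) ≤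
        ((edgeTime k + 2 * k + 200 : ℕ) : ℝ) * X :=
      mul_le_mul_of_nonneg_left h2 (Nat.cast_nonneg _)
    linarith
  cases kind with
  | deterministic =>
    obtain ⟨hdet, hrun⟩ := hpI
    refine ⟨reductionProgram_deterministic hdet, fun ω => ?_⟩
    obtain ⟨s, t, he, ht, hs⟩ := hrun ω
    obtain ⟨s', t', he', ht', hs'⟩ := reductionProgram_exec hk hα H hw1 he
    exact ⟨s', t', he', htime t t' ht ht', hs' hs⟩
  | randomized =>
    obtain ⟨hrun, hprob⟩ := hpI
    refine ⟨fun ω => ?_, hprob.trans (MeasureTheory.measure_mono ?_)⟩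
    · obtain ⟨s, t, he, ht⟩ := hrun ω
      obtain ⟨s', t', he', ht', -⟩ := reductionProgram_exec hk hα H hw1 he
      exact ⟨s', t', he', htime t t' ht ht'⟩
    · rintro ω ⟨s, t, he, hs⟩
      obtain ⟨s', t', he', -, hs'⟩ := reductionProgram_exec hk hα H hw1 he
      exact ⟨s', t', he', hs' hs⟩

theorem layeredInstance_n_rpow {k : ℕ} (hk : 4 ≤ k) (H : UniformHypergraph 3) (e : ℝ) :
    ((H.layeredInstance k (by omega)).n : ℝ) ^ e =
      ((k : ℝ) + 1) ^ e * (H.n : ℝ) ^ (((k : ℝ) - 2) * e) := by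
  change (((k + 1) * H.n ^ (k - 2) : ℕ) : ℝ) ^ e = _
  push_cast
  rw [Real.mul_rpow (by positivity) (by positivity), Real.rpow_mul (Nat.cast_nonneg _),
    ← Real.rpow_natCast, Nat.cast_sub (by omega)]
  norm_num

end FineGrained

theorem mainTheorem5 (kind : FineGrained.AlgKind) (k : ℕ) (hk : 4 ≤ k)
    (hyp : FineGrained.HypercliqueHypothesis kind k 3)
    (α : ℝ) (hα : α < 3 - 6 / (k : ℝ)) (ε : ℝ) (hε : 0 < ε) :
    (¬ (FineGrained.pairsMinDistApprox α).SolvableInTime kind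
        (fun I : FineGrained.PairsInstance =>
          (I.n : ℝ) ^ ((k : ℝ) / ((k : ℝ) - 2) - ε))) ∧
    (¬ (FineGrained.pairsMinDistApprox α).SolvableInTime kind
        (fun I : FineGrained.PairsInstance =>
          (I.m : ℝ) + (I.n : ℝ) ^ ((k : ℝ) / ((k : ℝ) - 2) - ε))) ∧
    (¬ (FineGrained.pairsMinDistApprox α).SolvableInTime kind
        (fun I : FineGrained.PairsInstance =>
          ((I.m : ℝ) + (I.n : ℝ)) * (I.n : ℝ) ^ (1 / ((k : ℝ) - 2) - ε))) := by
  have hk4 : (4 : ℝ) ≤ k := by exact_mod_cast hk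
  have hk2 : (0 : ℝ) < (k : ℝ) - 2 := by linarith
  set δ := min 1 (((k : ℝ) - 2) * ε) with hδ
  have hδ0 : 0 < δ := lt_min one_pos (mul_pos hk2 hε)
  have hδ1 : δ ≤ 1 := min_le_left _ _
  have hδ2 : δ ≤ ((k : ℝ) - 2) * ε := min_le_right _ _
  have hn1 : ∀ H : FineGrained.UniformHypergraph 3, (1 : ℝ) ≤ H.n := fun H => by exact_mod_cast H.n_pos
  have hpow : ∀ H : FineGrained.UniformHypergraph 3,
      ((H.layeredInstance k (by omega)).n : ℝ) ^ ((k : ℝ) / ((k : ℝ) - 2) - ε) ≤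
        ((k : ℝ) + 1) ^ ((k : ℝ) / ((k : ℝ) - 2) - ε) * (H.n : ℝ) ^ ((k : ℝ) - δ) := by
    intro H
    rw [FineGrained.layeredInstance_n_rpow hk]
    refine mul_le_mul_of_nonneg_left
      (Real.rpow_le_rpow_of_exponent_le (hn1 H) ?_) (by positivity)
    have h : ((k : ℝ) - 2) * ((k : ℝ) / ((k : ℝ) - 2) - ε) = k - ((k : ℝ) - 2) * ε := by
      field_simp
    linarith
  have hm : ∀ H : FineGrained.UniformHypergraph 3,
      ((H.layeredInstance k (by omega)).m : ℝ) ≤ k * (H.n : ℝ) ^ ((k : ℝ) - 1) := by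
    intro H
    have h1 := H.layeredInstance_m_le k (by omega)
    have hU : H.layerSize k * H.n = H.n ^ (k - 1) := by
      rw [FineGrained.UniformHypergraph.layerSize, ← pow_succ]; congr 1; omega
    have h2 : (H.n : ℝ) ^ ((k : ℝ) - 1) = (H.n : ℝ) ^ (k - 1) := by
      rw [← Real.rpow_natCast, Nat.cast_sub (by omega), Nat.cast_one]
    rw [hU] at h1
    rw [h2]
    exact_mod_cast h1
  refine ⟨?_, ?_, ?_⟩
  · exact FineGrained.not_solvableInTime_of_hypercliqueHypothesis hk hyp hα _ hδ0 hδ1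
      (fun I => by positivity) hpow
  · refine FineGrained.not_solvableInTime_of_hypercliqueHypothesis hk hyp hα _ hδ0 hδ1
      (K := k + ((k : ℝ) + 1) ^ ((k : ℝ) / ((k : ℝ) - 2) - ε))
      (fun I => by positivity) fun H => ?_
    rw [add_mul]
    refine add_le_add ((hm H).trans (mul_le_mul_of_nonneg_left ?_ (by positivity))) (hpow H)
    exact Real.rpow_le_rpow_of_exponent_le (hn1 H) (by linarith)
  · refine FineGrained.not_solvableInTime_of_hypercliqueHypothesis hk hyp hα _ hδ0 hδ1
      (K := (2 * k + 1) * ((k : ℝ) + 1) ^ (1 / ((k : ℝ) - 2) - ε))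
      (fun I => by positivity) fun H => ?_
    have hpos : (0 : ℝ) < H.n := one_pos.trans_le (hn1 H)
    have hn : ((H.layeredInstance k (by omega)).n : ℝ) ≤
        (k + 1) * (H.n : ℝ) ^ ((k : ℝ) - 1) := by
      have h := FineGrained.layeredInstance_n_rpow hk H 1
      rw [Real.rpow_one, Real.rpow_one, mul_one] at h
      rw [h]
      exact mul_le_mul_of_nonneg_left
        (Real.rpow_le_rpow_of_exponent_le (hn1 H) (by linarith)) (by positivity)
    have he : ((k : ℝ) - 2) * (1 / ((k : ℝ) - 2) - ε) = 1 - ((k : ℝ) - 2) * ε := by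
      field_simp
    rw [FineGrained.layeredInstance_n_rpow hk, he]
    have hsum : ((H.layeredInstance k (by omega)).m : ℝ) + (H.layeredInstance k (by omega)).n ≤
        (2 * k + 1) * (H.n : ℝ) ^ ((k : ℝ) - 1) := by
      linarith [hm H]
    have hprod : (H.n : ℝ) ^ ((k : ℝ) - 1) * (H.n : ℝ) ^ (1 - ((k : ℝ) - 2) * ε) ≤
        (H.n : ℝ) ^ ((k : ℝ) - δ) := by
      rw [← Real.rpow_add hpos]
      exact Real.rpow_le_rpow_of_exponent_le (hn1 H) (by linarith)
    calc _ ≤ (2 * k + 1) * (H.n : ℝ) ^ ((k : ℝ) - 1) *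
          (((k : ℝ) + 1) ^ (1 / ((k : ℝ) - 2) - ε) *
            (H.n : ℝ) ^ (1 - ((k : ℝ) - 2) * ε)) :=
          mul_le_mul_of_nonneg_right hsum (by positivity)
      _ = (2 * k + 1) * ((k : ℝ) + 1) ^ (1 / ((k : ℝ) - 2) - ε) *
          ((H.n : ℝ) ^ ((k : ℝ) - 1) * (H.n : ℝ) ^ (1 - ((k : ℝ) - 2) * ε)) := by ring
      _ ≤ _ := mul_le_mul_of_nonneg_left hprod (by positivity)
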